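/- Let $\alpha\in(1,2)$ and $\lambda>0$. Let $0<T_1<T_2<\dots$ be the successive arrival times of a homogeneous Poisson process with rate $\lambda$, and let $(F_u)_u$ be a measurable family of probability distributions on $\mathbb R$. Let $R_1,R_2,\dots$ be real random variables (the noises) which, conditionally on $(T_i)_{i\ge1}$, are independent, $R_j=R_j(T_j)$ having distribution $F_{T_j}$. Put $K_m(u)=\int_{\mathbb R}x^m\,F_u(dx)$ for $u>0$, and assume that these moments are finite for $m=1,2,3,4$, that $K_1(u)=0$ for all $u>0$, that $K_2$ and $K_4$ are positive and bounded on $(0,\infty)$, that $\lim_{u\to\infty}K_2(u)=K>0$, and that $K_4(u)/K_2(u)\le\kappa$ for all $u>0$ and some constant $\kappa>0$. Let $$S(t)=\sum_{j\ge1}(\log t-\log T_j)_+^{(\alpha-1)/2}R_j(T_j)\quad(t>0),\qquad S(0)=0,$$ $$\hat S_{\alpha,c}(t)=\frac{S(ct)}{\sqrt{c\,K\lambda\Gamma(\alpha)}},\qquad t\ge0,\ c>0.$$ For real $z\ge0$ and real non-integer $b$, let $\Psi$ be Tricomi's confluent hypergeometric function $$\Psi(a,b;z)=\frac{\Gamma(1-b)}{\Gamma(1+a-b)}\Phi(a,b;z)+\frac{\Gamma(b-1)}{\Gamma(a)}z^{1-b}\,\Phi(1+a-b,2-b;z),\qquad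 \Phi(a,b;z)=\sum_{l\ge0}\frac{(a)_l}{(b)_l}\frac{z^l}{l!},$$ where $(x)_l=x(x+1)\cdots(x+l-1)$, and let $C_\alpha=2^{1-\alpha}\sqrt\pi/\Gamma(\alpha/2)$. Then there exists a centred Gaussian process $B^H_\alpha=(B^H_\alpha(t))_{t\ge0}$ with covariance $$\operatorname{Cov}\big(B^H_\alpha(s),B^H_\alpha(t)\big)=C_\alpha\,(s\wedge t)\,\Psi\!\left(\tfrac{1-\alpha}{2},1-\alpha;\log\tfrac{s\vee t}{s\wedge t}\right)\ (s,t>0),\qquad B^H_\alpha(0)=0\ \text{a.s.}$$ (the Hadamard fractional Brownian motion, unique in law), and $\hat S_{\alpha,c}$ converges to $B^H_\alpha$ in the sense of finite-dimensional distributions as $c\to+\infty$: for all $n\ge1$ and $t_1,\dots,t_n\ge0$, the vector $(\hat S_{\alpha,c}(t_1),\dots,\hat S_{\alpha,c}(t_n))$ converges in distribution to $(B^H_\alpha(t_1),\dots,B^H_\alpha(t_n))$. -/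

import Mathlib

open MeasureTheory ProbabilityTheory Filter Topology
open scoped NNReal ENNReal

noncomputable section

namespace HadamardShotNoise

/-- Kummer's confluent hypergeometric function `Φ(a, b; z) = ∑ₗ (a)ₗ / (b)ₗ · zˡ / l!`
(for `b` not a non-positive integer), with `(c)ₗ = c (c + 1) ⋯ (c + l - 1)`. -/
def kummerPhi (a b z : ℝ) : ℝ :=
  ∑' l : ℕ, (ascPochhammer ℝ l).eval a / (ascPochhammer ℝ l).eval b * (z ^ l / (l.factorial : ℝ))

/-- Tricomi's confluent hypergeometric function `Ψ(a, b; z)` for real `z ≥ 0` and real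
non-integer `b`, expressed through Kummer's function. -/
def tricomiPsi (a b z : ℝ) : ℝ :=
  Real.Gamma (1 - b) / Real.Gamma (1 + a - b) * kummerPhi a b z +
    Real.Gamma (b - 1) / Real.Gamma a * z ^ (1 - b) * kummerPhi (1 + a - b) (2 - b) z

/-- The constant `C_α = 2 ^ (1 - α) √π / Γ(α / 2)`. -/
def constC (α : ℝ) : ℝ := 2 ^ (1 - α) * √Real.pi / Real.Gamma (α / 2)

/-- The covariance of Hadamard fractional Brownian motion,
`C_α (s ∧ t) Ψ((1 - α)/2, 1 - α; log ((s ∨ t) / (s ∧ t)))`; it vanishes if `s` or `t` is `0`. -/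
def hadamardCov (α : ℝ) (s t : ℝ≥0) : ℝ :=
  constC α * min (s : ℝ) (t : ℝ) *
    tricomiPsi ((1 - α) / 2) (1 - α) (Real.log (max (s : ℝ) (t : ℝ) / min (s : ℝ) (t : ℝ)))

/-- `B` is (in law) a Hadamard fractional Brownian motion with parameter `α`: a centred Gaussian
process indexed by `[0, ∞)` with covariance `hadamardCov α`. -/
structure IsHadamardFBM {Ω : Type*} [MeasurableSpace Ω] (α : ℝ) (P : Measure Ω)
    (B : ℝ≥0 → Ω → ℝ) : Prop where
  isGaussianProcess : IsGaussianProcess B P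
  mean_zero : ∀ t, ∫ ω, B t ω ∂P = 0
  covariance_eq : ∀ s t, cov[B s, B t; P] = hadamardCov α s t

/-- The waiting times `T₀, T₁ - T₀, T₂ - T₁, …` of a sequence of epochs `T₀, T₁, T₂, …`. -/
def waitingTime {Ω : Type*} (T : ℕ → Ω → ℝ) : ℕ → Ω → ℝ
  | 0 => T 0
  | j + 1 => fun ω => T (j + 1) ω - T j ω

/-- `T₀, T₁, …` are the successive arrival times of a homogeneous Poisson process on `(0, ∞)` with
rate `r`: the waiting times are independent and exponentially distributed with parameter `r`.
(The epochs are numbered from `0` instead of `1`.) -/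
structure IsPoissonEpochs {Ω : Type*} [MeasurableSpace Ω] (r : ℝ) (T : ℕ → Ω → ℝ)
    (P : Measure Ω) : Prop where
  measurable : ∀ j, Measurable (T j)
  hasLaw : ∀ j, HasLaw (waitingTime T j) (expMeasure r) P
  iIndepFun : iIndepFun (waitingTime T) P

/-- Conditionally on all the epochs `(Tⱼ)ⱼ`, the noises `(Rⱼ)ⱼ` are independent and `Rⱼ` has
distribution `F_{Tⱼ}`: for finitely many Borel sets `Aⱼ`,
`P(Rⱼ ∈ Aⱼ for all j ∈ s | (Tᵢ)ᵢ) = ∏_{j ∈ s} F_{Tⱼ}(Aⱼ)` almost surely. -/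
structure IsNoiseGivenEpochs {Ω : Type*} [MeasurableSpace Ω] (F : Kernel ℝ ℝ)
    (T R : ℕ → Ω → ℝ) (P : Measure Ω) : Prop where
  measurable : ∀ j, Measurable (R j)
  condProb_eq : ∀ (s : Finset ℕ) (A : ℕ → Set ℝ), (∀ j, MeasurableSet (A j)) →
    P⟦⋂ j ∈ s, R j ⁻¹' A j | MeasurableSpace.comap (fun ω j => T j ω) inferInstance⟧
      =ᵐ[P] fun ω => ∏ j ∈ s, (F (T j ω)).real (A j)

/-- The conditional moment `K_m(u) = ∫ xᵐ F_u(dx)`. -/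
def condMoment (F : Kernel ℝ ℝ) (m : ℕ) (u : ℝ) : ℝ := ∫ x, x ^ m ∂(F u)

/-- The response function `g(x) = (log x) ^ β` for `x ≥ 1`, and `g(x) = 0` for `x < 1`. -/
def response (β x : ℝ) : ℝ := (Set.Ici (1 : ℝ)).indicator (fun y => Real.log y ^ β) x

/-- The shot noise `S_β(t) = ∑ⱼ g(t / Tⱼ) Rⱼ`, that is `∑ⱼ (log t - log Tⱼ)₊ ^ β Rⱼ` for `t > 0`,
and `0` for `t = 0`. Almost surely only finitely many terms are non-zero. -/
def shotNoise {Ω : Type*} (β : ℝ) (T R : ℕ → Ω → ℝ) (t : ℝ) (ω : Ω) : ℝ :=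
  ∑' j : ℕ, response β (t / T j ω) * R j ω

/-- The scaled shot noise `S_β(c t) / √(c K r Γ(α))` with `β = (α - 1) / 2` and rate `r`. -/
def scaledShotNoise {Ω : Type*} (α r K : ℝ) (T R : ℕ → Ω → ℝ) (c : ℝ) (t : ℝ≥0) (ω : Ω) : ℝ :=
  shotNoise ((α - 1) / 2) T R (c * (t : ℝ)) ω / √(c * (K * r * Real.Gamma α))

/-- Convergence of the finite-dimensional distributions of the processes `X c` to those of `Y`
as `c → ∞` through the reals. -/
def TendstoFDD {Ω Ω' : Type*} [MeasurableSpace Ω] [MeasurableSpace Ω']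
    (X : ℝ → ℝ≥0 → Ω → ℝ) (P : Measure Ω) [IsProbabilityMeasure P]
    (Y : ℝ≥0 → Ω' → ℝ) (P' : Measure Ω') [IsProbabilityMeasure P'] : Prop :=
  ∀ I : Finset ℝ≥0,
    TendstoInDistribution (fun c ω (t : I) => X c t ω) atTop (fun ω (t : I) => Y t ω)
      (fun _ => P) P'

end HadamardShotNoise

end

/-!
Conditionally on the epochs the noises are independent, so the characteristic function of a linear
combination of values of the shot noise is the expectation of a product over the epochs.
Conditioning on the first epoch gives a renewal equation for such expectations, whose solution is
Campbell's formula
`E exp (i ∑ⱼ h(Tⱼ) Rⱼ) = exp (r ∫₀^∞ (φᵤ(h(u)) - 1) du)`,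
where `φᵤ` is the characteristic function of `Fᵤ`. For the shot noise at the times `c t`, substitute
`u = c v`. As the noises are centred, Taylor expansion of `φ` shows that after scaling the exponent
tends to `-½ ∑ₛ ∑ₜ aₛ aₜ Γ(α)⁻¹ ∫₀^∞ g(s / v) g(t / v) dv`, with `g = (log ·)₊ ^ ((α - 1) / 2)`, and
the Cramér–Wold device turns this into convergence of the finite-dimensional distributions.

For `s ≤ t` the substitution `v = s e⁻ˣ` brings the integral into the form
`s ∫₀^∞ e⁻ˣ xᵝ (x + log (t / s))ᵝ dx` with `β = (α - 1) / 2`, an integral representation of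
Tricomi's function; it is identified by its differential equation and its behaviour at `0`. The
covariance is therefore a Gram matrix in `L²(0, ∞)`, so the limit process exists: it is the image of
the functions `v ↦ g(t / v)` under an isonormal Gaussian map.
-/

namespace HadamardShotNoise

section Kummer

variable {a b : ℝ}

/-- The Taylor coefficients of Kummer's function `Φ(a, b; ·)` at `0`. -/
noncomputable def kummerCoeff (a b : ℝ) (l : ℕ) : ℝ :=
  (ascPochhammer ℝ l).eval a / (ascPochhammer ℝ l).eval b / (l.factorial : ℝ)

lemma kummerPhi_eq_tsum (a b z : ℝ) : kummerPhi a b z = ∑' l, kummerCoeff a b l * z ^ l :=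
  tsum_congr fun l => by rw [kummerCoeff]; ring

lemma kummerCoeff_zero (a b : ℝ) : kummerCoeff a b 0 = 1 := by simp [kummerCoeff]

lemma kummerCoeff_succ (a b : ℝ) (l : ℕ) :
    kummerCoeff a b (l + 1) = (a + l) / ((b + l) * (l + 1)) * kummerCoeff a b l := by
  simp only [kummerCoeff, ascPochhammer_succ_eval, Nat.factorial_succ, Nat.cast_mul,
    Nat.cast_add_one, div_eq_mul_inv, mul_inv]
  ring

lemma succ_mul_kummerCoeff_succ (a b : ℝ) (l : ℕ) :
    (l + 1) * kummerCoeff a b (l + 1) = a / b * kummerCoeff (a + 1) (b + 1) l := by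
  have hl : (l : ℝ) + 1 ≠ 0 := by positivity
  simp only [kummerCoeff, ascPochhammer_succ_left, Polynomial.eval_mul, Polynomial.eval_X,
    Polynomial.eval_comp, Polynomial.eval_add, Polynomial.eval_one, Nat.factorial_succ,
    Nat.cast_mul, Nat.cast_add_one]
  field_simp

lemma add_mul_kummerCoeff (a b : ℝ) (l : ℕ) :
    (a + l) * kummerCoeff a b l = a * kummerCoeff (a + 1) b l := by
  have h : (ascPochhammer ℝ l).eval a * (a + l) = a * (ascPochhammer ℝ l).eval (a + 1) := by
    rw [← ascPochhammer_succ_eval, ascPochhammer_succ_left]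
    simp
  simp only [kummerCoeff]
  linear_combination h / (ascPochhammer ℝ l).eval b / (l.factorial : ℝ)

lemma add_mul_kummerCoeff_add_one (hb : ∀ l : ℕ, b ≠ -l) (l : ℕ) :
    (b + l) * kummerCoeff a (b + 1) l = b * kummerCoeff a b l := by
  have hb0 : b ≠ 0 := by simpa using hb 0
  have hbl : b + l ≠ 0 := fun h => hb l (eq_neg_of_add_eq_zero_left h)
  have h : (ascPochhammer ℝ l).eval b * (b + l) = b * (ascPochhammer ℝ l).eval (b + 1) := by
    rw [← ascPochhammer_succ_eval, ascPochhammer_succ_left]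
    simp
  have h' : (ascPochhammer ℝ l).eval (b + 1) = (ascPochhammer ℝ l).eval b * (b + l) / b := by
    rw [h]; field_simp
  rw [kummerCoeff, kummerCoeff, h']
  field_simp

lemma summable_kummerCoeff (a b z : ℝ) :
    Summable fun l => kummerCoeff a b l * z ^ l := by
  have hratio : Tendsto (fun l : ℕ => (a + l) / (b + l) * (z / ((l : ℝ) + 1))) atTop (𝓝 0) := by
    have h1 : Tendsto (fun l : ℕ => (a + l) / (b + l)) atTop (𝓝 1) := by
      simpa using tendsto_add_mul_div_add_mul_atTop_nhds a b 1 (one_ne_zero (α := ℝ))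
    have h2 : Tendsto (fun l : ℕ => z / ((l : ℝ) + 1)) atTop (𝓝 0) :=
      tendsto_const_nhds.div_atTop (tendsto_atTop_add_const_right _ _ tendsto_natCast_atTop_atTop)
    simpa using h1.mul h2
  refine summable_of_ratio_norm_eventually_le (r := 1 / 2) (by norm_num) ?_
  filter_upwards [(tendsto_zero_iff_norm_tendsto_zero.1 hratio).eventually_le_const
    (by norm_num : (0 : ℝ) < 1 / 2)] with l hl
  calc ‖kummerCoeff a b (l + 1) * z ^ (l + 1)‖
      = ‖(a + l) / (b + l) * (z / ((l : ℝ) + 1))‖ * ‖kummerCoeff a b l * z ^ l‖ := by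
        rw [← norm_mul, kummerCoeff_succ, div_mul_eq_div_mul_one_div _ (b + l)]
        congr 1
        ring
    _ ≤ 1 / 2 * ‖kummerCoeff a b l * z ^ l‖ := by gcongr

lemma hasSum_kummerPhi (a b z : ℝ) :
    HasSum (fun l => kummerCoeff a b l * z ^ l) (kummerPhi a b z) :=
  kummerPhi_eq_tsum a b z ▸ (summable_kummerCoeff a b z).hasSum

lemma kummerPhi_zero (a b : ℝ) : kummerPhi a b 0 = 1 := by
  rw [kummerPhi_eq_tsum, tsum_eq_single 0 fun l hl => by simp [hl]]
  simp [kummerCoeff_zero]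

lemma one_le_kummerPhi {z : ℝ} (ha : 0 ≤ a) (hb : 0 < b) (hz : 0 ≤ z) : 1 ≤ kummerPhi a b z := by
  have hnonneg : ∀ l, 0 ≤ kummerCoeff a b l := fun l => by
    induction l with
    | zero => simp [kummerCoeff_zero]
    | succ n ih => rw [kummerCoeff_succ]; positivity
  simpa [kummerCoeff_zero] using
    le_hasSum (hasSum_kummerPhi a b z) 0 fun l _ => mul_nonneg (hnonneg l) (pow_nonneg hz l)

lemma hasSum_natCast_mul_kummerCoeff (a b z : ℝ) :
    HasSum (fun l : ℕ => l * (kummerCoeff a b l * z ^ l))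
      (z * (a / b * kummerPhi (a + 1) (b + 1) z)) := by
  rw [← hasSum_nat_add_iff' 1]
  simp only [Finset.range_one, Finset.sum_singleton, Nat.cast_zero, zero_mul, sub_zero]
  refine (((hasSum_kummerPhi _ _ z).mul_left (a / b)).mul_left z).congr_fun
    fun l => ?_
  rw [← mul_assoc (a / b), ← succ_mul_kummerCoeff_succ]
  push_cast
  ring

lemma hasDerivAt_kummerPhi (a b z : ℝ) :
    HasDerivAt (kummerPhi a b) (a / b * kummerPhi (a + 1) (b + 1) z) z := by
  have hderiv : ∀ y : ℝ, HasSum (fun l : ℕ => kummerCoeff a b l * (l * y ^ (l - 1)))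
      (a / b * kummerPhi (a + 1) (b + 1) y) := fun y => by
    rw [← hasSum_nat_add_iff' 1]
    simp only [Finset.range_one, Finset.sum_singleton, Nat.cast_zero, zero_mul, mul_zero, sub_zero]
    refine ((hasSum_kummerPhi _ _ y).mul_left (a / b)).congr_fun fun l => ?_
    rw [← mul_assoc (a / b), ← succ_mul_kummerCoeff_succ, Nat.add_sub_cancel]
    push_cast
    ring
  have hbound : Summable fun l : ℕ => ‖kummerCoeff a b l * (l * (|z| + 1) ^ (l - 1))‖ :=
    (hderiv (|z| + 1)).summable.norm
  rw [funext (kummerPhi_eq_tsum a b), ← (hderiv z).tsum_eq]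
  refine hasDerivAt_tsum_of_isPreconnected (t := Metric.ball (0 : ℝ) (|z| + 1)) (y₀ := 0)
    (g := fun l y => kummerCoeff a b l * y ^ l)
    (g' := fun l y => kummerCoeff a b l * (l * y ^ (l - 1))) hbound Metric.isOpen_ball
    (convex_ball _ _).isPreconnected (fun l y _ => (hasDerivAt_pow l y).const_mul _)
    (fun l y hy => ?_)
    (Metric.mem_ball_self (by positivity)) (summable_kummerCoeff a b 0) (by simp)
  have hy' : |y| ≤ |z| + 1 := by simpa using (Metric.mem_ball.1 hy).le
  simp only [norm_mul, norm_pow, Real.norm_eq_abs, abs_of_nonneg (by positivity : 0 ≤ |z| + 1)]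
  gcongr

lemma continuous_kummerPhi (a b : ℝ) : Continuous (kummerPhi a b) :=
  continuous_iff_continuousAt.2 fun z => (hasDerivAt_kummerPhi a b z).continuousAt

lemma mul_kummerPhi_add_one_left (a b z : ℝ) :
    a * kummerPhi (a + 1) b z =
      a * kummerPhi a b z + z * (a / b * kummerPhi (a + 1) (b + 1) z) := by
  refine ((hasSum_kummerPhi _ _ z).mul_left a).unique
    ((((hasSum_kummerPhi _ _ z).mul_left a).add (hasSum_natCast_mul_kummerCoeff _ _ z)).congr_fun
      fun l => ?_)
  rw [← mul_assoc, ← add_mul_kummerCoeff]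
  ring

lemma mul_kummerPhi_eq_add_one_right (hb : ∀ l : ℕ, b ≠ -l) (z : ℝ) :
    b * kummerPhi a b z =
      b * kummerPhi a (b + 1) z + z * (a / (b + 1) * kummerPhi (a + 1) (b + 1 + 1) z) := by
  refine ((hasSum_kummerPhi _ _ z).mul_left b).unique
    ((((hasSum_kummerPhi _ _ z).mul_left b).add (hasSum_natCast_mul_kummerCoeff _ _ z)).congr_fun
      fun l => ?_)
  rw [← mul_assoc, ← add_mul_kummerCoeff_add_one hb]
  ring

lemma hasDerivAt_rpow_mul_kummerPhi (hb : ∀ l : ℕ, b ≠ -l) {z : ℝ} (hz : z ≠ 0) :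
    HasDerivAt (fun z => z ^ b * kummerPhi a (b + 1) z)
      (b * z ^ (b - 1) * kummerPhi a b z) z := by
  refine ((Real.hasDerivAt_rpow_const (Or.inl hz)).mul
    (hasDerivAt_kummerPhi _ _ z)).congr_deriv ?_
  have hpow : z ^ b = z ^ (b - 1) * z := by rw [← Real.rpow_add_one hz, sub_add_cancel]
  rw [hpow]
  linear_combination -z ^ (b - 1) * mul_kummerPhi_eq_add_one_right (a := a) hb z

end Kummer

lemma eq_of_hasDerivAt_zero_of_tendsto {f : ℝ → ℝ} {c : ℝ} (hf : ∀ z > 0, HasDerivAt f 0 z)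
    (hlim : Tendsto f (𝓝[>] 0) (𝓝 c)) {z : ℝ} (hz : 0 < z) : f z = c := by
  have hconst : ∀ᶠ y in 𝓝[>] (0 : ℝ), f y = f z := by
    filter_upwards [self_mem_nhdsWithin] with y hy
    exact (convex_Ioi (0 : ℝ)).is_const_of_fderivWithin_eq_zero
      (fun x hx => (hf x hx).differentiableAt.differentiableWithinAt)
      (fun x hx => by
        rw [fderivWithin_of_isOpen isOpen_Ioi hx, (hf x hx).hasFDerivAt.fderiv]
        ext
        simp) hy hz
  exact tendsto_nhds_unique (tendsto_const_nhds.congr' (hconst.mono fun _ h => h.symm)) hlim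

section KummerEquation

variable {a b : ℝ} {f g f₁ g₁ f₂ g₂ : ℝ → ℝ}

/-- Kummer's differential equation `z f'' + (b - z) f' = a f` on `(0, ∞)` in self-adjoint form
`(zᵇ e⁻ᶻ f')' = a zᵇ⁻¹ e⁻ᶻ f`, written as a first-order system for `f` and its flux
`g = zᵇ e⁻ᶻ f'`. -/
structure IsKummerSolution (a b : ℝ) (f g : ℝ → ℝ) : Prop where
  hasDerivAt : ∀ z > 0, HasDerivAt f (z ^ (-b) * Real.exp z * g z) z
  hasDerivAt_flux : ∀ z > 0, HasDerivAt g (a * z ^ (b - 1) * Real.exp (-z) * f z) z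

namespace IsKummerSolution

lemma sub (h₁ : IsKummerSolution a b f₁ g₁) (h₂ : IsKummerSolution a b f₂ g₂) :
    IsKummerSolution a b (f₁ - f₂) (g₁ - g₂) where
  hasDerivAt z hz := ((h₁.hasDerivAt z hz).sub (h₂.hasDerivAt z hz)).congr_deriv (by
    simp only [Pi.sub_apply]; ring)
  hasDerivAt_flux z hz := ((h₁.hasDerivAt_flux z hz).sub (h₂.hasDerivAt_flux z hz)).congr_deriv (by
    simp only [Pi.sub_apply]; ring)

lemma const_smul (h : IsKummerSolution a b f g) (c : ℝ) :
    IsKummerSolution a b (c • f) (c • g) where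
  hasDerivAt z hz := ((h.hasDerivAt z hz).const_smul c).congr_deriv (by
    simp only [Pi.smul_apply, smul_eq_mul]; ring)
  hasDerivAt_flux z hz := ((h.hasDerivAt_flux z hz).const_smul c).congr_deriv (by
    simp only [Pi.smul_apply, smul_eq_mul]; ring)

lemma hasDerivAt_wronskian (h₁ : IsKummerSolution a b f₁ g₁) (h₂ : IsKummerSolution a b f₂ g₂)
    {z : ℝ} (hz : 0 < z) : HasDerivAt (fun z => f₁ z * g₂ z - f₂ z * g₁ z) 0 z :=
  (((h₁.hasDerivAt z hz).mul (h₂.hasDerivAt_flux z hz)).sub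
    ((h₂.hasDerivAt z hz).mul (h₁.hasDerivAt_flux z hz))).congr_deriv (by ring)

end IsKummerSolution

lemma isKummerSolution_kummerPhi (a : ℝ) (hb : ∀ l : ℕ, b ≠ -l) :
    IsKummerSolution a b (kummerPhi a b)
      (fun z => a / b * (Real.exp (-z) * (z ^ b * kummerPhi (a + 1) (b + 1) z))) where
  hasDerivAt z hz := (hasDerivAt_kummerPhi a b z).congr_deriv (by
    rw [Real.rpow_neg hz.le, Real.exp_neg]
    field_simp)
  hasDerivAt_flux z hz := by
    refine (((hasDerivAt_neg z).exp.mul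
      (hasDerivAt_rpow_mul_kummerPhi (a := a + 1) hb hz.ne')).const_mul (a / b)).congr_deriv ?_
    have hb0 : b ≠ 0 := by simpa using hb 0
    have hpow : z ^ b = z ^ (b - 1) * z := by rw [← Real.rpow_add_one hz.ne', sub_add_cancel]
    have hcontig := mul_kummerPhi_add_one_left a b z
    rw [hpow]
    field_simp at hcontig ⊢
    linear_combination hcontig

lemma isKummerSolution_rpow_mul_kummerPhi (a : ℝ) (hb : ∀ l : ℕ, 1 - b ≠ -l) :
    IsKummerSolution a b (fun z => z ^ (1 - b) * kummerPhi (1 + a - b) (1 - b + 1) z)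
      (fun z => (1 - b) * (Real.exp (-z) * kummerPhi (1 + a - b) (1 - b) z)) where
  hasDerivAt z hz := (hasDerivAt_rpow_mul_kummerPhi hb hz.ne').congr_deriv (by
    rw [Real.exp_neg, sub_sub_cancel_left]
    field_simp)
  hasDerivAt_flux z hz := by
    refine (((hasDerivAt_neg z).exp.mul
      (hasDerivAt_kummerPhi (1 + a - b) (1 - b) z)).const_mul (1 - b)).congr_deriv ?_
    have hb0 : 1 - b ≠ 0 := by simpa using hb 0
    have hpow : z ^ (b - 1) * z ^ (1 - b) = 1 := by
      rw [← Real.rpow_add hz]; simp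
    have h1 := mul_kummerPhi_add_one_left (1 + a - b) (1 - b + 1) z
    have h2 := mul_kummerPhi_eq_add_one_right (a := 1 + a - b) hb z
    field_simp
    linear_combination h1 - h2 - a * kummerPhi (1 + a - b) (1 - b + 1) z * hpow

lemma tendsto_kummerPhi_nhdsGT_zero (a b : ℝ) : Tendsto (kummerPhi a b) (𝓝[>] 0) (𝓝 1) :=
  kummerPhi_zero a b ▸ (continuous_kummerPhi a b).continuousWithinAt

lemma tendsto_exp_neg_nhdsGT_zero : Tendsto (fun z => Real.exp (-z)) (𝓝[>] 0) (𝓝 1) := by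
  simpa using ((by fun_prop : Continuous fun z : ℝ => Real.exp (-z)).tendsto 0).mono_left
    nhdsWithin_le_nhds

lemma tendsto_rpow_nhdsGT_zero {s : ℝ} (hs : 0 < s) :
    Tendsto (fun z : ℝ => z ^ s) (𝓝[>] 0) (𝓝 0) := by
  simpa [Real.zero_rpow hs.ne'] using
    ((Real.continuous_rpow_const hs.le).tendsto 0).mono_left nhdsWithin_le_nhds

lemma tendsto_flux_kummerPhi (a : ℝ) (hb : 0 < b) :
    Tendsto (fun z => a / b * (Real.exp (-z) * (z ^ b * kummerPhi (a + 1) (b + 1) z)))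
      (𝓝[>] 0) (𝓝 0) := by
  simpa using (tendsto_exp_neg_nhdsGT_zero.mul ((tendsto_rpow_nhdsGT_zero hb).mul
    (tendsto_kummerPhi_nhdsGT_zero (a + 1) (b + 1)))).const_mul (a / b)

lemma tendsto_rpow_mul_kummerPhi (a : ℝ) (hb : b < 1) :
    Tendsto (fun z => z ^ (1 - b) * kummerPhi (1 + a - b) (1 - b + 1) z) (𝓝[>] 0) (𝓝 0) := by
  simpa using (tendsto_rpow_nhdsGT_zero (sub_pos.2 hb)).mul
    (tendsto_kummerPhi_nhdsGT_zero (1 + a - b) (1 - b + 1))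

lemma tendsto_flux_rpow_mul_kummerPhi (a b : ℝ) :
    Tendsto (fun z => (1 - b) * (Real.exp (-z) * kummerPhi (1 + a - b) (1 - b) z))
      (𝓝[>] 0) (𝓝 (1 - b)) := by
  simpa using (tendsto_exp_neg_nhdsGT_zero.mul
    (tendsto_kummerPhi_nhdsGT_zero (1 + a - b) (1 - b))).const_mul (1 - b)

lemma IsKummerSolution.eq_zero (h : IsKummerSolution a b f g) (ha : 0 ≤ a) (hb : 0 < b)
    (hf : Tendsto f (𝓝[>] 0) (𝓝 0)) (hg : Tendsto g (𝓝[>] 0) (𝓝 0)) {z : ℝ} (hz : 0 < z) :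
    f z = 0 := by
  have hb' : ∀ l : ℕ, b ≠ -l := fun l => by linarith [l.cast_nonneg (α := ℝ)]
  have hΦ := isKummerSolution_kummerPhi a hb'
  have hΦpos : ∀ y > 0, kummerPhi a b y ≠ 0 := fun y hy =>
    (zero_lt_one.trans_le (one_le_kummerPhi ha hb (le_of_lt hy))).ne'
  have hΦlim := tendsto_kummerPhi_nhdsGT_zero a b
  have hwronskian {y : ℝ} (hy : 0 < y) :=
    eq_of_hasDerivAt_zero_of_tendsto (c := 0) (fun _ => h.hasDerivAt_wronskian hΦ)
      (by simpa using (hf.mul (tendsto_flux_kummerPhi a hb)).sub (hΦlim.mul hg)) hy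
  have hquot : ∀ y > 0, HasDerivAt (fun y => f y / kummerPhi a b y) 0 y := fun y hy =>
    ((h.hasDerivAt y hy).div (hΦ.hasDerivAt y hy) (hΦpos y hy)).congr_deriv (by
      rw [div_eq_zero_iff]
      left
      linear_combination -y ^ (-b) * Real.exp y * hwronskian hy)
  have hzero : f z / kummerPhi a b z = 0 :=
    eq_of_hasDerivAt_zero_of_tendsto hquot
      (by simpa [Pi.div_def] using hf.div hΦlim one_ne_zero) hz
  exact (div_eq_zero_iff.1 hzero).resolve_right (hΦpos z hz)

end KummerEquation

section ExpRpowIntegral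

variable {p q r L : ℝ}

/-- The integral `∫₀^∞ e⁻ˣ xᵖ (x + L)^q dx`. For `L > 0` and `p > -1` it equals
`Γ(p + 1) Ψ(-q, -(p + q); L)`, a variant of the usual integral representation of Tricomi's function
that converges for every real `q`. -/
noncomputable def expRpowIntegral (p q L : ℝ) : ℝ :=
  ∫ x in Set.Ioi (0 : ℝ), Real.exp (-x) * x ^ p * (x + L) ^ q

lemma integrableOn_exp_neg_mul_rpow (hp : -1 < p) :
    IntegrableOn (fun x => Real.exp (-x) * x ^ p) (Set.Ioi 0) := by
  simpa using Real.GammaIntegral_convergent (s := p + 1) (by linarith)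

lemma integral_exp_neg_mul_rpow (hp : -1 < p) :
    ∫ x in Set.Ioi (0 : ℝ), Real.exp (-x) * x ^ p = Real.Gamma (p + 1) := by
  rw [Real.Gamma_eq_integral (by linarith)]
  simp

lemma rpow_le_rpow_add_rpow {m x M : ℝ} (q : ℝ) (hm : 0 < m) (hmx : m ≤ x) (hxM : x ≤ M) :
    x ^ q ≤ m ^ q + M ^ q := by
  have hm' : 0 ≤ m ^ q := by positivity
  have hM' : 0 ≤ M ^ q := Real.rpow_nonneg (by linarith) q
  rcases le_total q 0 with hq | hq
  · linarith [Real.rpow_le_rpow_of_nonpos hm hmx hq]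
  · linarith [Real.rpow_le_rpow (by linarith) hxM hq]

lemma integrableOn_expRpow (hp : -1 < p) (hL : 0 < L) (q : ℝ) :
    IntegrableOn (fun x => Real.exp (-x) * x ^ p * (x + L) ^ q) (Set.Ioi 0) := by
  have hbound : IntegrableOn (fun x => (L ^ q + (2 * L) ^ q) * (Real.exp (-x) * x ^ p) +
      2 ^ |q| * (Real.exp (-x) * x ^ (p + |q|))) (Set.Ioi 0) :=
    ((integrableOn_exp_neg_mul_rpow hp).const_mul _).add
      ((integrableOn_exp_neg_mul_rpow (by linarith [abs_nonneg q])).const_mul _)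
  refine hbound.mono' (by fun_prop) ?_
  filter_upwards [ae_restrict_mem measurableSet_Ioi] with x (hx : 0 < x)
  have hle : (x + L) ^ q ≤ L ^ q + (2 * L) ^ q + 2 ^ |q| * x ^ |q| := by
    rw [← Real.mul_rpow zero_le_two hx.le]
    have hnonneg : 0 ≤ (2 * x) ^ |q| := by positivity
    rcases le_total x L with h | h
    · linarith [rpow_le_rpow_add_rpow (x := x + L) (M := 2 * L) q hL (by linarith) (by linarith)]
    · have hL2 : 0 ≤ (2 * L) ^ q := by positivity
      rcases le_total q 0 with hq | hq
      · linarith [Real.rpow_le_rpow_of_nonpos hL (by linarith : L ≤ x + L) hq]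
      · rw [abs_of_nonneg hq] at hnonneg ⊢
        linarith [rpow_le_rpow_add_rpow (x := x + L) (M := 2 * x) q hL (by linarith) (by linarith)]
  rw [Real.norm_of_nonneg (by positivity)]
  calc Real.exp (-x) * x ^ p * (x + L) ^ q
      ≤ Real.exp (-x) * x ^ p * (L ^ q + (2 * L) ^ q + 2 ^ |q| * x ^ |q|) := by gcongr
    _ = _ := by rw [Real.rpow_add hx]; ring

lemma hasDerivAt_expRpowIntegral (hp : -1 < p) (hL : 0 < L) (q : ℝ) :
    HasDerivAt (expRpowIntegral p q) (q * expRpowIntegral p (q - 1) L) L := by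
  have hbound : IntegrableOn (fun x => |q| * (Real.exp (-x) * x ^ p * (x + L / 2) ^ (q - 1) +
      Real.exp (-x) * x ^ p * (x + 2 * L) ^ (q - 1))) (Set.Ioi 0) :=
    ((integrableOn_expRpow hp (by positivity) _).add
      (integrableOn_expRpow hp (by positivity) _)).const_mul _
  have hderiv := hasDerivAt_integral_of_dominated_loc_of_deriv_le
    (F := fun L x => Real.exp (-x) * x ^ p * (x + L) ^ q)
    (F' := fun L x => q * (Real.exp (-x) * x ^ p * (x + L) ^ (q - 1)))
    (Ioo_mem_nhds (by linarith : L / 2 < L) (by linarith : L < 2 * L))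
    (.of_forall fun L => by fun_prop) (integrableOn_expRpow hp hL q) (by fun_prop) ?_ hbound ?_
  · exact hderiv.2.congr_deriv (integral_const_mul _ _)
  · filter_upwards [ae_restrict_mem measurableSet_Ioi] with x (hx : 0 < x) y hy
    have hy0 : 0 < y := by linarith [hy.1]
    rw [norm_mul, Real.norm_eq_abs q, Real.norm_of_nonneg (by positivity), ← mul_add]
    gcongr
    exact rpow_le_rpow_add_rpow _ (by positivity) (by linarith [hy.1]) (by linarith [hy.2])
  · filter_upwards [ae_restrict_mem measurableSet_Ioi] with x (hx : 0 < x) y hy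
    exact ((((hasDerivAt_id y).const_add x).rpow_const (p := q)
      (Or.inl (by simp only [id]; linarith [hy.1]))).const_mul (Real.exp (-x) * x ^ p)).congr_deriv
      (by simp only [id]; ring)

lemma expRpowIntegral_zero (hpq : -1 < p + q) :
    expRpowIntegral p q 0 = Real.Gamma (p + q + 1) := by
  rw [← integral_exp_neg_mul_rpow hpq, expRpowIntegral]
  refine setIntegral_congr_fun measurableSet_Ioi fun x (hx : 0 < x) => ?_
  rw [add_zero, Real.rpow_add hx, mul_assoc]

lemma tendsto_expRpowIntegral (hp : -1 < p) (hpq : -1 < p + q) :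
    Tendsto (expRpowIntegral p q) (𝓝[>] 0) (𝓝 (Real.Gamma (p + q + 1))) := by
  rw [← expRpowIntegral_zero hpq]
  have hbound : IntegrableOn (fun x => Real.exp (-x) * x ^ (p + q) +
      Real.exp (-x) * x ^ p * (x + 1) ^ q) (Set.Ioi 0) :=
    (integrableOn_exp_neg_mul_rpow hpq).add (integrableOn_expRpow hp zero_lt_one q)
  refine tendsto_integral_filter_of_dominated_convergence _
    (.of_forall fun L => by fun_prop) ?_ hbound ?_
  · filter_upwards [Ioo_mem_nhdsGT (zero_lt_one' ℝ)] with L hL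
    filter_upwards [ae_restrict_mem measurableSet_Ioi] with x (hx : 0 < x)
    have hL0 : 0 < L := hL.1
    rw [Real.norm_of_nonneg (by positivity), Real.rpow_add hx, ← mul_assoc, ← mul_add]
    gcongr
    exact rpow_le_rpow_add_rpow _ hx (by linarith) (by linarith [hL.2])
  · filter_upwards [ae_restrict_mem measurableSet_Ioi] with x (hx : 0 < x)
    have hcont : ContinuousAt (fun L => Real.exp (-x) * x ^ p * (x + L) ^ q) 0 :=
      continuousAt_const.mul
        (ContinuousAt.rpow_const (by fun_prop) (Or.inl (by simpa using hx.ne')))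
    exact hcont.tendsto.mono_left nhdsWithin_le_nhds

lemma expRpowIntegral_eq_add (hp : 0 < p) (hL : 0 < L) (q : ℝ) :
    expRpowIntegral p q L = p * expRpowIntegral (p - 1) q L + q * expRpowIntegral p (q - 1) L := by
  have hint1 := integrableOn_expRpow (by linarith : -1 < p) hL q
  have hint2 := (integrableOn_expRpow (by linarith : -1 < p - 1) hL q).const_mul p
  have hint3 := (integrableOn_expRpow (by linarith : -1 < p) hL (q - 1)).const_mul q
  have hint23 : IntegrableOn (fun x => p * (Real.exp (-x) * x ^ (p - 1) * (x + L) ^ q) +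
      q * (Real.exp (-x) * x ^ p * (x + L) ^ (q - 1))) (Set.Ioi 0) := hint2.add hint3
  have hderiv : ∀ x ∈ Set.Ioi (0 : ℝ), HasDerivAt (fun x => Real.exp (-x) * x ^ p * (x + L) ^ q)
      (p * (Real.exp (-x) * x ^ (p - 1) * (x + L) ^ q) +
        q * (Real.exp (-x) * x ^ p * (x + L) ^ (q - 1)) -
        Real.exp (-x) * x ^ p * (x + L) ^ q) x := fun x (hx : 0 < x) =>
    (((hasDerivAt_neg x).exp.mul (Real.hasDerivAt_rpow_const (p := p) (Or.inl hx.ne'))).mul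
      (((hasDerivAt_id x).add_const L).rpow_const (p := q)
        (Or.inl (by simp only [id]; positivity)))).congr_deriv (by
          simp only [id, Pi.mul_apply]; ring)
  have hcont : ContinuousWithinAt (fun x => Real.exp (-x) * x ^ p * (x + L) ^ q) (Set.Ici 0) 0 :=
    (((by fun_prop : Continuous fun x : ℝ => Real.exp (-x)).continuousAt.mul
      (Real.continuousAt_rpow_const _ _ (Or.inr hp.le))).mul
      (ContinuousAt.rpow_const (by fun_prop) (Or.inl (by simpa using hL.ne')))).continuousWithinAt
  have hzero := integral_Ioi_of_hasDerivAt_of_tendsto hcont hderiv (hint23.sub hint1)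
    (tendsto_zero_of_hasDerivAt_of_integrableOn_Ioi hderiv (hint23.sub hint1) hint1)
  rw [integral_sub hint23 hint1, integral_add hint2 hint3, integral_const_mul,
    integral_const_mul, Real.zero_rpow hp.ne', mul_zero, zero_mul, sub_zero] at hzero
  exact (sub_eq_zero.1 hzero).symm

lemma integral_rpow_mul_rpow_mul_exp (hr : -1 < r) (hL : 0 < L) (p : ℝ) {x : ℝ} (hx : 0 < x) :
    ∫ y in Set.Ioi (0 : ℝ), x ^ p * y ^ r * Real.exp (-(x + y + x * y / L)) =
      Real.Gamma (r + 1) * L ^ (r + 1) * (Real.exp (-x) * x ^ p * (x + L) ^ (-(r + 1))) := by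
  have hgamma := Real.integral_rpow_mul_exp_neg_mul_Ioi (a := r + 1) (r := (x + L) / L)
    (by linarith) (by positivity)
  rw [add_sub_cancel_right, one_div_div, Real.div_rpow hL.le (by positivity)] at hgamma
  calc ∫ y in Set.Ioi (0 : ℝ), x ^ p * y ^ r * Real.exp (-(x + y + x * y / L))
    _ = ∫ y in Set.Ioi 0, Real.exp (-x) * x ^ p * (y ^ r * Real.exp (-((x + L) / L * y))) := by
        refine integral_congr_ae (.of_forall fun y => ?_)
        have hexp : -(x + y + x * y / L) = -x + -((x + L) / L * y) := by field_simp; ring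
        simp only [hexp, Real.exp_add]
        ring
    _ = _ := by
        rw [integral_const_mul, hgamma, Real.rpow_neg (by positivity)]
        ring

lemma integrable_rpow_mul_rpow_mul_exp (hp : -1 < p) (hr : -1 < r) (hL : 0 < L) :
    Integrable (Function.uncurry fun x y => x ^ p * y ^ r * Real.exp (-(x + y + x * y / L)))
      ((volume.restrict (Set.Ioi 0)).prod (volume.restrict (Set.Ioi 0))) := by
  have hmeas : Measurable (Function.uncurry fun x y : ℝ =>
      x ^ p * y ^ r * Real.exp (-(x + y + x * y / L))) := by
    simp only [Function.uncurry_def]; fun_prop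
  refine (integrable_prod_iff hmeas.aestronglyMeasurable).2 ⟨?_, ?_⟩
  · filter_upwards [ae_restrict_mem measurableSet_Ioi] with x (hx : 0 < x)
    refine .of_integral_ne_zero (ne_of_gt ?_)
    have hΓ := Real.Gamma_pos_of_pos (by linarith : 0 < r + 1)
    simp only [Function.uncurry_apply_pair, integral_rpow_mul_rpow_mul_exp hr hL p hx]
    positivity
  · refine ((integrableOn_expRpow hp hL (-(r + 1))).const_mul
      (Real.Gamma (r + 1) * L ^ (r + 1))).congr ?_
    filter_upwards [ae_restrict_mem measurableSet_Ioi] with x (hx : 0 < x)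
    rw [← integral_rpow_mul_rpow_mul_exp hr hL p hx]
    refine setIntegral_congr_fun measurableSet_Ioi fun y (hy : 0 < y) => ?_
    simp only [Function.uncurry_apply_pair]
    rw [Real.norm_of_nonneg (by positivity)]

lemma integral_integral_rpow_mul_rpow_mul_exp (hr : -1 < r) (hL : 0 < L) (p : ℝ) :
    ∫ x in Set.Ioi 0, ∫ y in Set.Ioi 0, x ^ p * y ^ r * Real.exp (-(x + y + x * y / L)) =
      Real.Gamma (r + 1) * L ^ (r + 1) * expRpowIntegral p (-(r + 1)) L := by
  rw [setIntegral_congr_fun measurableSet_Ioi fun x hx =>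
    integral_rpow_mul_rpow_mul_exp hr hL p hx, integral_const_mul, expRpowIntegral]

/- Kummer's transformation `Ψ(a, b; z) = z¹⁻ᵇ Ψ(1 + a - b, 2 - b; z)`: both sides are the double
integral of the kernel `xᵖ yʳ exp (-(x + y + x y / L))`, which is symmetric in `(x, p)` and
`(y, r)`. -/
lemma gamma_mul_expRpowIntegral_comm (hp : -1 < p) (hr : -1 < r) (hL : 0 < L) :
    Real.Gamma (r + 1) * L ^ (r + 1) * expRpowIntegral p (-(r + 1)) L =
      Real.Gamma (p + 1) * L ^ (p + 1) * expRpowIntegral r (-(p + 1)) L := by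
  rw [← integral_integral_rpow_mul_rpow_mul_exp hr hL,
    ← integral_integral_rpow_mul_rpow_mul_exp hp hL,
    integral_integral_swap (integrable_rpow_mul_rpow_mul_exp hp hr hL)]
  refine integral_congr_ae (.of_forall fun y => integral_congr_ae (.of_forall fun x => ?_))
  simp only [mul_comm (x ^ p), mul_comm x y, add_comm x y]

end ExpRpowIntegral

section TricomiPsi

variable {a b p q L : ℝ}

lemma isKummerSolution_expRpowIntegral (hp : -1 < p) (hq : q < 0) :
    IsKummerSolution (-q) (-(p + q)) (expRpowIntegral p q) (fun z =>
      -(Real.Gamma (p + 1) / Real.Gamma (-q)) *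
        (Real.exp (-z) * expRpowIntegral (-q) (-(p + 1)) z)) where
  hasDerivAt z hz := (hasDerivAt_expRpowIntegral hp hz q).congr_deriv (by
    have hcomm := gamma_mul_expRpowIntegral_comm hp (by linarith : -1 < -q) hz
    have hΓ : Real.Gamma (-q) ≠ 0 := (Real.Gamma_pos_of_pos (by linarith)).ne'
    have hpow : z ^ (p + q) * z ^ (-q + 1) = z ^ (p + 1) := by
      rw [← Real.rpow_add hz]; ring_nf
    rw [Real.Gamma_add_one (by linarith), ← hpow, show -(-q + 1) = q - 1 by ring] at hcomm
    have hz' : z ^ (-q + 1) ≠ 0 := by positivity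
    have hJ : -q * Real.Gamma (-q) * expRpowIntegral p (q - 1) z =
        Real.Gamma (p + 1) * z ^ (p + q) * expRpowIntegral (-q) (-(p + 1)) z :=
      mul_left_cancel₀ hz' (by linear_combination hcomm)
    rw [Real.exp_neg, neg_neg]
    field_simp
    linear_combination -hJ)
  hasDerivAt_flux z hz := by
    refine (((hasDerivAt_neg z).exp.mul (hasDerivAt_expRpowIntegral (by linarith : -1 < -q) hz
      (-(p + 1)))).const_mul _).congr_deriv ?_
    have hcomm := gamma_mul_expRpowIntegral_comm hp (by linarith : -1 < -q - 1) hz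
    have hparts := expRpowIntegral_eq_add (by linarith : 0 < -q) hz (-(p + 1))
    have hΓ : Real.Gamma (-q) ≠ 0 := (Real.Gamma_pos_of_pos (by linarith)).ne'
    have hpow : z ^ (-(p + q) - 1) * z ^ (p + 1) = z ^ (-q) := by
      rw [← Real.rpow_add hz]; ring_nf
    rw [sub_add_cancel, neg_neg, ← hpow] at hcomm
    have hJ : Real.Gamma (-q) * z ^ (-(p + q) - 1) * expRpowIntegral p q z =
        Real.Gamma (p + 1) * expRpowIntegral (-q - 1) (-(p + 1)) z :=
      mul_left_cancel₀ (by positivity : z ^ (p + 1) ≠ 0) (by linear_combination hcomm)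
    field_simp
    linear_combination Real.Gamma (p + 1) * hparts + q * hJ

/- Both sides solve Kummer's equation; because `0 < b < 1`, where `b = -(p + q)`, the fundamental
solutions and their fluxes have limits at `0`, and these limits agree for the two sides. -/
lemma expRpowIntegral_eq_tricomiPsi_of_add_neg (hq : q < 0) (hpq : -1 < p + q) (hpq0 : p + q < 0)
    (hL : 0 < L) :
    expRpowIntegral p q L = Real.Gamma (p + 1) * tricomiPsi (-q) (-(p + q)) L := by
  have hp : -1 < p := by linarith
  set b : ℝ := -(p + q) with _
  have hb0 : ∀ l : ℕ, b ≠ -l := fun l => by linarith [l.cast_nonneg (α := ℝ)]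
  have hb1 : ∀ l : ℕ, 1 - b ≠ -l := fun l => by linarith [l.cast_nonneg (α := ℝ)]
  have hΓ : Real.Gamma b = (b - 1) * Real.Gamma (b - 1) := by
    rw [← Real.Gamma_add_one (by linarith), sub_add_cancel]
  have hΓp : Real.Gamma (p + 1) ≠ 0 := (Real.Gamma_pos_of_pos (by linarith)).ne'
  set k : ℝ := Real.Gamma (p + 1) * Real.Gamma (b - 1) / Real.Gamma (-q) with hk
  have hsol := ((isKummerSolution_expRpowIntegral hp hq).sub
    ((isKummerSolution_kummerPhi (-q) hb0).const_smul (Real.Gamma (1 - b)))).sub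
    ((isKummerSolution_rpow_mul_kummerPhi (-q) hb1).const_smul k)
  have hlim := ((tendsto_expRpowIntegral hp hpq).sub
    ((tendsto_kummerPhi_nhdsGT_zero (-q) b).const_smul (Real.Gamma (1 - b)))).sub
    ((tendsto_rpow_mul_kummerPhi (-q) (by linarith : b < 1)).const_smul k)
  have hfluxJ := (tendsto_exp_neg_nhdsGT_zero.mul (tendsto_expRpowIntegral (by linarith : -1 < -q)
    (by linarith : -1 < -q + -(p + 1)))).const_mul (-(Real.Gamma (p + 1) / Real.Gamma (-q)))
  have hflux := (hfluxJ.sub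
    ((tendsto_flux_kummerPhi (-q) (by linarith : 0 < b)).const_smul (Real.Gamma (1 - b)))).sub
    ((tendsto_flux_rpow_mul_kummerPhi (-q) b).const_smul k)
  rw [show p + q + 1 = 1 - b by ring, smul_eq_mul, mul_one, smul_zero, sub_self, sub_self] at hlim
  have hflux0 : -(Real.Gamma (p + 1) / Real.Gamma (-q)) * (1 * Real.Gamma b) -
      Real.Gamma (1 - b) • 0 - k • (1 - b) = 0 := by
    rw [hΓ, hk, smul_eq_mul, smul_eq_mul]
    ring
  rw [show -q + -(p + 1) + 1 = b by ring, hflux0] at hflux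
  have hzero : expRpowIntegral p q L - Real.Gamma (1 - b) * kummerPhi (-q) b L -
      k * (L ^ (1 - b) * kummerPhi (1 + -q - b) (1 - b + 1) L) = 0 :=
    hsol.eq_zero (by linarith) (by linarith) hlim hflux hL
  rw [show 1 + -q - b = p + 1 by ring] at hzero
  rw [tricomiPsi, show 1 + -q - b = p + 1 by ring, show 2 - b = 1 - b + 1 by ring, mul_add,
    ← mul_assoc, mul_div_cancel₀ _ hΓp]
  linear_combination hzero

lemma hasDerivAt_tricomiPsi (a : ℝ) (hb : b < 0) (hL : 0 < L) :
    HasDerivAt (tricomiPsi a b) (-a * tricomiPsi (a + 1) (b + 1) L) L := by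
  have hb1 : ∀ l : ℕ, 1 - b ≠ -l := fun l => by linarith [l.cast_nonneg (α := ℝ)]
  have hderiv := ((hasDerivAt_kummerPhi a b L).const_mul (Real.Gamma (1 - b) /
    Real.Gamma (1 + a - b))).add ((hasDerivAt_rpow_mul_kummerPhi (a := 1 + a - b) hb1
      hL.ne').const_mul (Real.Gamma (b - 1) / Real.Gamma a))
  have hΓ1 : Real.Gamma (1 - b) = -b * Real.Gamma (-b) := by
    rw [← Real.Gamma_add_one (by linarith), neg_add_eq_sub]
  have hΓ2 : Real.Gamma b = (b - 1) * Real.Gamma (b - 1) := by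
    rw [← Real.Gamma_add_one (by linarith), sub_add_cancel]
  have hΓ3 : a / Real.Gamma (a + 1) = 1 / Real.Gamma a := by
    rcases eq_or_ne a 0 with rfl | ha
    · simp
    · rw [Real.Gamma_add_one ha]; field_simp
  refine (hderiv.congr_of_eventuallyEq (.of_forall fun z => ?_)).congr_deriv ?_
  · simp only [tricomiPsi, Pi.add_apply, show 2 - b = 1 - b + 1 by ring]
    ring
  · rw [tricomiPsi, show 1 - (b + 1) = -b by ring, show 1 + (a + 1) - (b + 1) = 1 + a - b by ring,
      show b + 1 - 1 = b by ring, show 2 - (b + 1) = 1 - b by ring, show 1 - b - 1 = -b by ring,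
      hΓ1, hΓ2]
    field_simp [hb.ne]
    linear_combination (b - 1) * Real.Gamma (b - 1) * L ^ (-b) * kummerPhi (1 + a - b) (1 - b) L *
      hΓ3

lemma continuous_tricomiPsi (a : ℝ) (hb : b ≤ 1) : Continuous (tricomiPsi a b) :=
  (continuous_const.mul (continuous_kummerPhi _ _)).add
    ((continuous_const.mul (Real.continuous_rpow_const (by linarith))).mul
      (continuous_kummerPhi _ _))

lemma tricomiPsi_zero (a : ℝ) (hb : b < 1) :
    tricomiPsi a b 0 = Real.Gamma (1 - b) / Real.Gamma (1 + a - b) := by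
  rw [tricomiPsi, kummerPhi_zero, Real.zero_rpow (by linarith)]
  ring

lemma expRpowIntegral_zero_eq_tricomiPsi (hp : -1 < p) (hpq : -1 < p + q) :
    expRpowIntegral p q 0 = Real.Gamma (p + 1) * tricomiPsi (-q) (-(p + q)) 0 := by
  have hΓ : Real.Gamma (p + 1) ≠ 0 := (Real.Gamma_pos_of_pos (by linarith)).ne'
  rw [expRpowIntegral_zero hpq, tricomiPsi_zero _ (by linarith),
    show 1 + -q - -(p + q) = p + 1 by ring, show 1 - -(p + q) = p + q + 1 by ring,
    mul_div_cancel₀ _ hΓ]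

lemma expRpowIntegral_eq_tricomiPsi_succ (hp : -1 < p) (hpq : -1 < p + q)
    (h : ∀ L > 0, expRpowIntegral p q L = Real.Gamma (p + 1) * tricomiPsi (-q) (-(p + q)) L)
    (hL : 0 < L) :
    expRpowIntegral p (q + 1) L =
      Real.Gamma (p + 1) * tricomiPsi (-(q + 1)) (-(p + (q + 1))) L := by
  have hderiv : ∀ z > 0, HasDerivAt (fun z => expRpowIntegral p (q + 1) z -
      Real.Gamma (p + 1) * tricomiPsi (-(q + 1)) (-(p + (q + 1))) z) 0 z := fun z hz =>
    ((hasDerivAt_expRpowIntegral hp hz (q + 1)).sub ((hasDerivAt_tricomiPsi (-(q + 1))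
      (by linarith) hz).const_mul (Real.Gamma (p + 1)))).congr_deriv (by
        rw [add_sub_cancel_right, h z hz, show -(q + 1) + 1 = -q by ring,
          show -(p + (q + 1)) + 1 = -(p + q) by ring]
        ring)
  have hlim : Tendsto (fun z => expRpowIntegral p (q + 1) z -
      Real.Gamma (p + 1) * tricomiPsi (-(q + 1)) (-(p + (q + 1))) z) (𝓝[>] 0) (𝓝 0) := by
    have hpq1 : -1 < p + (q + 1) := by linarith
    have hΨ := ((continuous_tricomiPsi (-(q + 1)) (by linarith : -(p + (q + 1)) ≤ 1)).tendsto
      0).mono_left (nhdsWithin_le_nhds (s := Set.Ioi 0))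
    have hsub := (tendsto_expRpowIntegral hp hpq1).sub (hΨ.const_mul (Real.Gamma (p + 1)))
    rwa [← expRpowIntegral_zero_eq_tricomiPsi hp hpq1, expRpowIntegral_zero hpq1, sub_self] at hsub
  exact sub_eq_zero.1 (eq_of_hasDerivAt_zero_of_tendsto hderiv hlim hL)

lemma expRpowIntegral_add_natCast_eq_tricomiPsi (hq : q < 0) (hpq : -1 < p + q) (hpq0 : p + q < 0)
    (k : ℕ) (hL : 0 < L) :
    expRpowIntegral p (q + k) L =
      Real.Gamma (p + 1) * tricomiPsi (-(q + k)) (-(p + (q + k))) L := by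
  induction k generalizing L with
  | zero => simpa using expRpowIntegral_eq_tricomiPsi_of_add_neg hq hpq hpq0 hL
  | succ k ih =>
    have : (0 : ℝ) ≤ k := k.cast_nonneg
    simpa only [Nat.cast_add_one, ← add_assoc] using
      expRpowIntegral_eq_tricomiPsi_succ (by linarith) (by linarith) (fun L hL => ih hL) hL

lemma expRpowIntegral_self_eq_tricomiPsi {β : ℝ} (hβ : -1 < 2 * β) (hβ' : ∀ n : ℕ, 2 * β ≠ n)
    (hL : 0 ≤ L) :
    expRpowIntegral β β L = Real.Gamma (β + 1) * tricomiPsi (-β) (-(2 * β)) L := by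
  rw [two_mul] at hβ ⊢
  rcases hL.eq_or_lt with rfl | hL
  · exact expRpowIntegral_zero_eq_tricomiPsi (by linarith) hβ
  have hceil : 2 * β < ⌈2 * β⌉₊ := (Nat.le_ceil _).lt_of_ne (hβ' _)
  have hceil' : (⌈2 * β⌉₊ : ℝ) < 2 * β + 1 := by
    rcases lt_or_ge (2 * β) 0 with h | h
    · rw [Nat.ceil_eq_zero.2 h.le]
      push_cast
      linarith
    · exact Nat.ceil_lt_add_one h
  have hneg : β - ⌈2 * β⌉₊ < 0 := by linarith [(⌈2 * β⌉₊).cast_nonneg (α := ℝ)]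
  simpa using expRpowIntegral_add_natCast_eq_tricomiPsi (p := β) hneg (by linarith) (by linarith)
    ⌈2 * β⌉₊ hL

end TricomiPsi

section Response

variable {β : ℝ}

lemma measurable_response (β : ℝ) : Measurable (response β) :=
  (Real.measurable_log.pow_const β).indicator measurableSet_Ici

lemma measurable_response_div (β t : ℝ) : Measurable fun v => response β (t / v) :=
  (measurable_response β).comp (measurable_const.div measurable_id)

lemma response_of_lt {x : ℝ} (hx : x < 1) : response β x = 0 :=
  Set.indicator_of_notMem (not_le.2 hx) _

lemma response_of_ge {x : ℝ} (hx : 1 ≤ x) : response β x = Real.log x ^ β :=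
  Set.indicator_of_mem hx _

lemma response_div_of_lt {s v : ℝ} (hv : 0 < v) (hsv : s < v) : response β (s / v) = 0 :=
  response_of_lt ((div_lt_one hv).2 hsv)

lemma response_div_mul_exp_neg {s t x : ℝ} (hs : 0 < s) (hst : s ≤ t) (hx : 0 ≤ x) :
    response β (t / (s * Real.exp (-x))) = (x + Real.log (t / s)) ^ β := by
  have hts : 1 ≤ t / s := (one_le_div hs).2 hst
  have hdiv : t / (s * Real.exp (-x)) = Real.exp x * (t / s) := by
    rw [Real.exp_neg]
    field_simp
  rw [hdiv, response_of_ge (one_le_mul_of_one_le_of_one_le (Real.one_le_exp hx) hts),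
    Real.log_mul (Real.exp_pos x).ne' (by positivity), Real.log_exp]

end Response

section ExpSubstitution

variable {s : ℝ} {g : ℝ → ℝ}

lemma image_mul_exp_neg (hs : 0 < s) :
    (fun x => s * Real.exp (-x)) '' Set.Ici 0 = Set.Ioc 0 s := by
  ext v
  constructor
  · rintro ⟨x, hx, rfl⟩
    exact ⟨by positivity,
      mul_le_of_le_one_right hs.le (Real.exp_le_one_iff.2 (neg_nonpos.2 hx))⟩
  · rintro ⟨hv, hvs⟩
    refine ⟨Real.log (s / v), Real.log_nonneg ((one_le_div hv).2 hvs), ?_⟩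
    simp only [Real.exp_neg, Real.exp_log (div_pos hs hv), inv_div, mul_div_cancel₀ _ hs.ne']

lemma hasDerivAt_mul_exp_neg (s x : ℝ) :
    HasDerivAt (fun x => s * Real.exp (-x)) (-(s * Real.exp (-x))) x := by
  simpa using ((hasDerivAt_neg x).exp).const_mul s

lemma injective_mul_exp_neg (hs : s ≠ 0) : Function.Injective fun x => s * Real.exp (-x) :=
  fun x y hxy => by simpa [hs] using hxy

lemma setIntegral_Ioi_eq_exp_subst (hs : 0 < s) (hg : ∀ v, s < v → g v = 0) :
    ∫ v in Set.Ioi 0, g v = ∫ x in Set.Ioi 0, s * Real.exp (-x) * g (s * Real.exp (-x)) := by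
  have hsupp : ∫ v in Set.Ioi 0, g v = ∫ v in Set.Ioc 0 s, g v :=
    setIntegral_eq_of_subset_of_forall_sdiff_eq_zero measurableSet_Ioi Set.Ioc_subset_Ioi_self
      fun v hv => hg v (not_le.1 fun h => hv.2 ⟨hv.1, h⟩)
  rw [hsupp, ← image_mul_exp_neg hs, integral_image_eq_integral_abs_deriv_smul measurableSet_Ici
    (fun x _ => (hasDerivAt_mul_exp_neg s x).hasDerivWithinAt)
    (injective_mul_exp_neg hs.ne').injOn, integral_Ici_eq_integral_Ioi]
  simp only [abs_neg, abs_of_pos (mul_pos hs (Real.exp_pos _)), smul_eq_mul]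

lemma integrableOn_Ioi_of_exp_subst (hs : 0 < s) (hg : ∀ v, s < v → g v = 0)
    (h : IntegrableOn (fun x => s * Real.exp (-x) * g (s * Real.exp (-x))) (Set.Ioi 0)) :
    IntegrableOn g (Set.Ioi 0) := by
  refine IntegrableOn.of_forall_sdiff_eq_zero (s := Set.Ioc 0 s) ?_ measurableSet_Ioi
    fun v hv => hg v (not_le.1 fun h => hv.2 ⟨hv.1, h⟩)
  rw [← image_mul_exp_neg hs, integrableOn_image_iff_integrableOn_abs_deriv_smul measurableSet_Ici
    (fun x _ => (hasDerivAt_mul_exp_neg s x).hasDerivWithinAt)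
    (injective_mul_exp_neg hs.ne').injOn, integrableOn_Ici_iff_integrableOn_Ioi]
  simpa only [abs_neg, abs_of_pos (mul_pos hs (Real.exp_pos _)), smul_eq_mul] using h

end ExpSubstitution

section Covariance

variable {α β : ℝ}

lemma memLp_response_div (hβ : -1 < 2 * β) (t : ℝ≥0) :
    MemLp (fun v => response β (t / v)) 2 (volume.restrict (Set.Ioi 0)) := by
  rw [memLp_two_iff_integrable_sq (measurable_response_div β t).aestronglyMeasurable]
  rcases eq_zero_or_pos t with rfl | ht
  · simp [response_of_lt]
  have ht : (0 : ℝ) < t := ht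
  refine integrableOn_Ioi_of_exp_subst ht (fun v hv => ?_) ?_
  · rw [response_div_of_lt (ht.trans hv) hv, zero_pow two_ne_zero]
  · refine IntegrableOn.congr_fun ((integrableOn_exp_neg_mul_rpow hβ).const_mul (t : ℝ))
      (fun x (hx : 0 < x) => ?_) measurableSet_Ioi
    rw [response_div_mul_exp_neg ht le_rfl hx.le, div_self ht.ne', Real.log_one, add_zero, two_mul,
      Real.rpow_add hx]
    ring

lemma integral_response_mul_response_eq_expRpowIntegral {s t : ℝ} (hs : 0 < s) (hst : s ≤ t) :
    ∫ v in Set.Ioi (0 : ℝ), response β (s / v) * response β (t / v) =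
      s * expRpowIntegral β β (Real.log (t / s)) := by
  rw [setIntegral_Ioi_eq_exp_subst hs, expRpowIntegral, ← integral_const_mul]
  · refine setIntegral_congr_fun measurableSet_Ioi fun x (hx : 0 < x) => ?_
    rw [response_div_mul_exp_neg hs le_rfl hx.le, response_div_mul_exp_neg hs hst hx.le,
      div_self hs.ne', Real.log_one, add_zero]
    ring
  · intro v hv
    rw [response_div_of_lt (hs.trans hv) hv, zero_mul]

lemma gamma_half_add_one_div_two_eq (hα : 0 < α) :
    Real.Gamma ((α - 1) / 2 + 1) = Real.Gamma α * constC α := by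
  have hdup := Real.Gamma_mul_Gamma_add_half (α / 2)
  rw [show α / 2 + 1 / 2 = (α - 1) / 2 + 1 by ring, mul_div_cancel₀ α two_ne_zero] at hdup
  have hΓ : Real.Gamma (α / 2) ≠ 0 := (Real.Gamma_pos_of_pos (half_pos hα)).ne'
  rw [constC, mul_div_assoc', eq_div_iff hΓ]
  linear_combination hdup

lemma hadamardCov_comm (α : ℝ) (s t : ℝ≥0) : hadamardCov α s t = hadamardCov α t s := by
  rw [hadamardCov, hadamardCov, min_comm, max_comm]

theorem integral_response_mul_response (hα : 0 < α) (hα' : ∀ n : ℕ, α ≠ n) (s t : ℝ≥0) :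
    ∫ v in Set.Ioi (0 : ℝ), response ((α - 1) / 2) (s / v) * response ((α - 1) / 2) (t / v) =
      Real.Gamma α * hadamardCov α s t := by
  wlog hst : s ≤ t generalizing s t
  · simpa only [hadamardCov_comm α s t, mul_comm] using this t s (le_of_not_ge hst)
  rcases eq_zero_or_pos s with rfl | hs
  · simp [response_of_lt, hadamardCov]
  have hst' : (s : ℝ) ≤ t := hst
  have hlog : 0 ≤ Real.log (t / s) := Real.log_nonneg ((one_le_div hs).2 hst')
  have hα'' (n : ℕ) : 2 * ((α - 1) / 2) ≠ n := fun h => hα' (n + 1) (by push_cast; linarith)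
  rw [integral_response_mul_response_eq_expRpowIntegral (NNReal.coe_pos.2 hs) hst',
    expRpowIntegral_self_eq_tricomiPsi (by linarith) hα'' hlog, gamma_half_add_one_div_two_eq hα,
    hadamardCov, min_eq_left hst', max_eq_right hst', show -((α - 1) / 2) = (1 - α) / 2 by ring,
    show -(2 * ((α - 1) / 2)) = 1 - α by ring]
  ring

end Covariance

section Isonormal

variable {Ω : Type*} [MeasurableSpace Ω] {P : Measure Ω}

lemma coeFn_sum_smul {ι : Type*} (f : ι → Lp ℝ 2 P) (s : Finset ι) (c : ι → ℝ) :
    ⇑(∑ i ∈ s, c i • f i) =ᵐ[P] fun ω => ∑ i ∈ s, c i * f i ω := by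
  have hsmul : ∀ᵐ ω ∂P, ∀ i ∈ s, (c i • f i) ω = c i * f i ω :=
    (Finset.eventually_all s).2 fun i _ => by
      filter_upwards [Lp.coeFn_smul (c i) (f i)] with ω hω using hω
  filter_upwards [Lp.coeFn_finsetSum s fun i => c i • f i, hsmul] with ω hsum hω
  rw [hsum, Finset.sum_apply, Finset.sum_congr rfl hω]

lemma integral_eq_zero_of_hasLaw_gaussianReal {v : ℝ≥0} {X : Ω → ℝ}
    (hX : HasLaw X (gaussianReal 0 v) P) : ∫ ω, X ω ∂P = 0 := by
  rw [hX.integral_eq, integral_id_gaussianReal]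

variable [IsProbabilityMeasure P]

lemma covariance_eq_inner {f : Lp ℝ 2 P} (hf : ∫ ω, f ω ∂P = 0) (g : Lp ℝ 2 P) :
    cov[f, g; P] = inner ℝ f g := by
  rw [covariance_eq_sub (Lp.memLp f) (Lp.memLp g), hf, zero_mul, sub_zero, L2.inner_def]
  simp only [Pi.mul_apply, RCLike.inner_apply, conj_trivial, mul_comm]

lemma variance_eq_norm_sq {f : Lp ℝ 2 P} (hf : ∫ ω, f ω ∂P = 0) : Var[f; P] = ‖f‖ ^ 2 := by
  rw [← covariance_self (Lp.aestronglyMeasurable f).aemeasurable, covariance_eq_inner hf,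
    real_inner_self_eq_norm_sq]

lemma tendsto_charFun_map_Lp {f : ℕ → Lp ℝ 2 P} {g : Lp ℝ 2 P} (hf : Tendsto f atTop (𝓝 g))
    (θ : ℝ) : Tendsto (fun n => charFun (P.map (f n)) θ) atTop (𝓝 (charFun (P.map g) θ)) :=
  ProbabilityMeasure.tendsto_iff_tendsto_charFun.1
    ((tendstoInMeasure_of_tendsto_Lp hf).tendstoInDistribution
      fun n => (Lp.aestronglyMeasurable (f n)).aemeasurable).tendsto θ

lemma isClosed_setOf_hasLaw_gaussianReal :
    IsClosed {f : Lp ℝ 2 P | HasLaw f (gaussianReal 0 (‖f‖₊ ^ 2)) P} := by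
  refine IsSeqClosed.isClosed fun f g hf hfg => ⟨(Lp.aestronglyMeasurable g).aemeasurable, ?_⟩
  have := Measure.isProbabilityMeasure_map (Lp.aestronglyMeasurable g).aemeasurable (μ := P)
  refine Measure.ext_of_charFun (funext fun θ => ?_)
  refine tendsto_nhds_unique (tendsto_charFun_map_Lp hfg θ) ?_
  simp only [(hf _).map_eq, charFun_gaussianReal]
  have hcont : Continuous fun h : Lp ℝ 2 P =>
      Complex.exp (θ * (0 : ℝ) * Complex.I - (‖h‖₊ ^ 2 : ℝ≥0) * θ ^ 2 / 2) := by
    fun_prop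
  exact (hcont.tendsto g).comp hfg

variable {ι : Type*} {ξ : ι → Lp ℝ 2 P}

lemma orthonormal_of_iIndepFun_gaussianReal (hξ : ∀ i, HasLaw (ξ i) (gaussianReal 0 1) P)
    (hindep : iIndepFun (fun i => ⇑(ξ i)) P) : Orthonormal ℝ ξ := by
  have hmean i := integral_eq_zero_of_hasLaw_gaussianReal (hξ i)
  refine ⟨fun i => ?_, fun i j hij => ?_⟩
  · have hsq : ‖ξ i‖ ^ 2 = 1 := by
      rw [← variance_eq_norm_sq (hmean i), (hξ i).variance_eq, variance_id_gaussianReal,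
        NNReal.coe_one]
    exact (pow_eq_one_iff_of_nonneg (norm_nonneg _) two_ne_zero).1 hsq
  · dsimp only
    rw [← covariance_eq_inner (hmean i)]
    exact (hindep.indepFun hij).covariance_eq_zero (Lp.memLp _) (Lp.memLp _)

lemma hasLaw_sum_smul_of_iIndepFun_gaussianReal (hξ : ∀ i, HasLaw (ξ i) (gaussianReal 0 1) P)
    (hindep : iIndepFun (fun i => ⇑(ξ i)) P) (s : Finset ι) (c : ι → ℝ) :
    HasLaw (∑ i ∈ s, c i • ξ i : Lp ℝ 2 P)
      (gaussianReal 0 (‖(∑ i ∈ s, c i • ξ i : Lp ℝ 2 P)‖₊ ^ 2)) P := by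
  have hae := coeFn_sum_smul ξ s c
  have hgauss : HasGaussianLaw (fun ω => ∑ i : s, c i * ξ i ω) P :=
    ((hindep.precomp Subtype.val_injective).comp (fun i : s => (c i * ·))
      fun i => by fun_prop).hasGaussianLaw_fun_sum fun i => (hξ i).hasGaussianLaw.fun_smul (c i)
  have hgauss : HasGaussianLaw (∑ i ∈ s, c i • ξ i : Lp ℝ 2 P) P := hgauss.congr <| by
    filter_upwards [hae] with ω hω
    rw [hω, Finset.sum_coe_sort s fun i => c i * ξ i ω]
  have hmean : ∫ ω, (∑ i ∈ s, c i • ξ i : Lp ℝ 2 P) ω ∂P = 0 := by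
    rw [integral_congr_ae hae, integral_finsetSum s fun i _ =>
      ((Lp.memLp (ξ i)).integrable one_le_two).const_mul (c i)]
    exact Finset.sum_eq_zero fun i _ => by
      rw [integral_const_mul, integral_eq_zero_of_hasLaw_gaussianReal (hξ i), mul_zero]
  refine ⟨hgauss.aemeasurable, hgauss.map_eq_gaussianReal.trans ?_⟩
  rw [hmean, variance_eq_norm_sq hmean]
  congr 1
  exact NNReal.eq (Real.coe_toNNReal _ (sq_nonneg _))

end Isonormal

universe u

theorem exists_isonormal (H : Type u) [NormedAddCommGroup H] [InnerProductSpace ℝ H]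
    [CompleteSpace H] :
    ∃ (Ω : Type u) (_ : MeasurableSpace Ω) (P : Measure Ω) (_ : IsProbabilityMeasure P)
      (V : H →ₗᵢ[ℝ] Lp ℝ 2 P), ∀ x, HasLaw (V x) (gaussianReal 0 (‖x‖₊ ^ 2)) P := by
  obtain ⟨w, b, -⟩ := exists_hilbertBasis ℝ H
  obtain ⟨Ω, _, P, X, -, hX, hindep, _⟩ := exists_iid w (gaussianReal 0 1)
  have hmem i : MemLp (X i) 2 P := (hX i).hasGaussianLaw.memLp_two
  have hcoe i : X i =ᵐ[P] (hmem i).toLp := (hmem i).coeFn_toLp.symm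
  have hξ i : HasLaw ((hmem i).toLp) (gaussianReal 0 1) P := (hX i).congr (hcoe i).symm
  replace hindep : iIndepFun (fun i => ⇑(hmem i).toLp) P := hindep.congr hcoe
  have horth := (orthonormal_of_iIndepFun_gaussianReal hξ hindep).orthogonalFamily
  refine ⟨Ω, _, P, ‹_›, horth.linearIsometry.comp b.repr.toLinearIsometry, fun x => ?_⟩
  have hlaw := isClosed_setOf_hasLaw_gaussianReal.mem_of_tendsto
    (horth.hasSum_linearIsometry (b.repr x))
    (.of_forall fun s => hasLaw_sum_smul_of_iIndepFun_gaussianReal hξ hindep s (b.repr x))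
  have hnorm : ‖horth.linearIsometry (b.repr x)‖₊ = ‖x‖₊ := by
    rw [LinearIsometry.nnnorm_map, LinearIsometryEquiv.nnnorm_map]
  rwa [Set.mem_ofPred_eq, hnorm] at hlaw

section GaussianProcess

variable {Ω T : Type*} [MeasurableSpace Ω] {P : Measure Ω}

lemma isGaussianProcess_of_hasGaussianLaw_sum {X : T → Ω → ℝ} (hX : ∀ t, AEMeasurable (X t) P)
    (h : ∀ (I : Finset T) (c : I → ℝ), HasGaussianLaw (fun ω => ∑ t, c t * X t ω) P) :
    IsGaussianProcess X P := by
  classical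
  refine ⟨fun I => ⟨isGaussian_of_isGaussian_map fun L => ?_⟩⟩
  have hrestrict : AEMeasurable (fun ω => I.restrict fun t => X t ω) P :=
    aemeasurable_pi_lambda _ fun t : I => hX t
  rw [AEMeasurable.map_map_of_aemeasurable (by fun_prop) hrestrict]
  convert (h I fun t => L (Pi.single t 1)).isGaussian_map using 3 with ω
  rw [Function.comp_apply, ← ContinuousLinearMap.coe_coe, LinearMap.pi_apply_eq_sum_univ]
  refine Finset.sum_congr rfl fun t _ => ?_
  rw [smul_eq_mul, mul_comm]
  congr 2
  ext u
  simp [Pi.single_apply, eq_comm]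

theorem exists_isGaussianProcess_covariance_eq_inner {H : Type u} [NormedAddCommGroup H]
    [InnerProductSpace ℝ H] [CompleteSpace H] (f : T → H) :
    ∃ (Ω : Type u) (_ : MeasurableSpace Ω) (P : Measure Ω) (B : T → Ω → ℝ),
      IsGaussianProcess B P ∧ (∀ t, ∫ ω, B t ω ∂P = 0) ∧
        ∀ s t, cov[B s, B t; P] = inner ℝ (f s) (f t) := by
  obtain ⟨Ω, _, P, _, V, hV⟩ := exists_isonormal H
  have hmean x := integral_eq_zero_of_hasLaw_gaussianReal (hV x)
  refine ⟨Ω, _, P, fun t => V (f t), ?_, fun t => hmean _, fun s t => ?_⟩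
  · refine isGaussianProcess_of_hasGaussianLaw_sum
      (fun t => (Lp.aestronglyMeasurable _).aemeasurable) fun I c => ?_
    refine (hV (∑ t : I, c t • f t)).hasGaussianLaw.congr ?_
    simpa only [map_sum, map_smul] using coeFn_sum_smul (fun t : I => V (f t)) .univ c
  · rw [covariance_eq_inner (hmean _), V.inner_map_map]

end GaussianProcess

lemma exists_isHadamardFBM {α : ℝ} (hα : 0 < α) (hα' : ∀ n : ℕ, α ≠ n) :
    ∃ (Ω₀ : Type) (_ : MeasurableSpace Ω₀) (P₀ : Measure Ω₀) (B₀ : ℝ≥0 → Ω₀ → ℝ),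
      IsHadamardFBM α P₀ B₀ := by
  have hmem t := memLp_response_div (β := (α - 1) / 2) (by linarith) t
  obtain ⟨Ω₀, _, P₀, B₀, hgauss, hmean, hcov⟩ := exists_isGaussianProcess_covariance_eq_inner
    fun t : ℝ≥0 => (√(Real.Gamma α))⁻¹ • (hmem t).toLp
  refine ⟨Ω₀, _, P₀, B₀, hgauss, hmean, fun s t => ?_⟩
  have hinner : inner ℝ ((hmem s).toLp) ((hmem t).toLp) = Real.Gamma α * hadamardCov α s t := by
    rw [← integral_response_mul_response hα hα', L2.inner_def]
    refine integral_congr_ae ?_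
    filter_upwards [(hmem s).coeFn_toLp, (hmem t).coeFn_toLp] with v hs ht
    rw [hs, ht, RCLike.inner_apply, conj_trivial, mul_comm]
  have hΓ := Real.Gamma_pos_of_pos hα
  rw [hcov, real_inner_smul_left, real_inner_smul_right, hinner, ← mul_assoc, ← mul_assoc,
    ← mul_inv, Real.mul_self_sqrt hΓ.le, inv_mul_cancel₀ hΓ.ne', one_mul]

section Exponential

variable {r : ℝ}

lemma integral_expMeasure {E : Type*} [NormedAddCommGroup E] [NormedSpace ℝ E] (hr : 0 < r)
    (k : ℝ → E) :
    ∫ x, k x ∂(expMeasure r) = ∫ x in Set.Ioi (0 : ℝ), (r * Real.exp (-(r * x))) • k x := by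
  have hdensity : ∫ x, k x ∂(expMeasure r) = ∫ x, (exponentialPDF r x).toReal • k x :=
    integral_withDensity_eq_integral_toReal_smul (measurable_gammaPDFReal 1 r).ennreal_ofReal
      (ae_of_all _ fun x => ENNReal.ofReal_lt_top) k
  rw [hdensity, ← integral_Ici_eq_integral_Ioi, ← integral_indicator measurableSet_Ici]
  congr 1 with x
  by_cases hx : 0 ≤ x
  · rw [Set.indicator_of_mem (Set.mem_Ici.2 hx), exponentialPDF_of_nonneg hx,
      ENNReal.toReal_ofReal (by positivity)]
  · rw [Set.indicator_of_notMem (by simpa using hx), exponentialPDF_of_neg (not_le.1 hx),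
      ENNReal.toReal_zero, zero_smul]

lemma integral_expMeasure_comp_add {E : Type*} [NormedAddCommGroup E] [NormedSpace ℝ E]
    (hr : 0 < r) (k : ℝ → E) (s : ℝ) :
    ∫ x, k (s + x) ∂(expMeasure r) =
      ∫ z in Set.Ioi s, (r * Real.exp (-(r * (z - s)))) • k z := by
  have hshift := (measurePreserving_add_left volume s).setIntegral_preimage_emb
    (measurableEmbedding_addLeft s) (fun z => (r * Real.exp (-(r * (z - s)))) • k z) (Set.Ioi s)
  rw [Set.preimage_const_add_Ioi, sub_self] at hshift
  simp only [integral_expMeasure hr, ← hshift, add_sub_cancel_left]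

lemma expMeasure_Ioi (hr : 0 < r) {x : ℝ} (hx : 0 ≤ x) :
    expMeasure r (Set.Ioi x) = ENNReal.ofReal (Real.exp (-(r * x))) := by
  have := isProbabilityMeasure_expMeasure hr
  have hexp : Real.exp (-(r * x)) ≤ 1 := Real.exp_le_one_iff.2 (by simpa using by positivity)
  rw [← Set.compl_Iic, prob_compl_eq_one_sub measurableSet_Iic, ← ofReal_cdf,
    cdf_expMeasure_eq hr, if_pos hx, ← ENNReal.ofReal_one,
    ← ENNReal.ofReal_sub _ (sub_nonneg.2 hexp), sub_sub_cancel]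

lemma ae_pos_expMeasure (hr : 0 < r) : ∀ᵐ x ∂(expMeasure r), 0 < x := by
  have := isProbabilityMeasure_expMeasure hr
  refine (mem_ae_iff_prob_eq_one measurableSet_Ioi).2 ?_
  simpa using expMeasure_Ioi hr le_rfl

end Exponential

section Epochs

variable {Ω : Type*} {r : ℝ} {T : ℕ → Ω → ℝ}

lemma sum_waitingTime (j : ℕ) (ω : Ω) :
    ∑ i ∈ Finset.range (j + 1), waitingTime T i ω = T j ω := by
  induction j with
  | zero => simp [waitingTime]
  | succ j ih => rw [Finset.sum_range_succ, ih, waitingTime, add_sub_cancel]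

lemma strictMono_of_waitingTime_pos {ω : Ω} (h : ∀ j, 0 < waitingTime T j ω) :
    StrictMono fun j => T j ω :=
  strictMono_nat_of_lt_succ fun j => sub_pos.1 (h (j + 1))

lemma tendsto_atTop_of_frequently_one_lt_waitingTime {ω : Ω} (hpos : ∀ j, 0 < waitingTime T j ω)
    (hlarge : ∃ᶠ j in atTop, 1 < waitingTime T j ω) : Tendsto (fun j => T j ω) atTop atTop := by
  refine (tendsto_atTop_of_monotone (strictMono_of_waitingTime_pos hpos).monotone).resolve_right ?_
  rintro ⟨l, hl⟩
  have hsucc : Tendsto (fun j => waitingTime T (j + 1) ω) atTop (𝓝 0) := by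
    simpa only [waitingTime, sub_self] using ((tendsto_add_atTop_iff_nat 1).2 hl).sub hl
  have hlt := ((tendsto_add_atTop_iff_nat (f := (waitingTime T · ω)) 1).1 hsucc).eventually
    (gt_mem_nhds one_pos)
  obtain ⟨j, hj, hj'⟩ := (hlarge.and_eventually hlt).exists
  exact lt_asymm hj hj'

variable [MeasurableSpace Ω] {P : Measure Ω}

lemma IsPoissonEpochs.measurable_waitingTime (hT : IsPoissonEpochs r T P) :
    ∀ j, Measurable (waitingTime T j)
  | 0 => hT.measurable 0
  | j + 1 => (hT.measurable (j + 1)).sub (hT.measurable j)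

lemma IsPoissonEpochs.ae_waitingTime_pos (hT : IsPoissonEpochs r T P) (hr : 0 < r) :
    ∀ᵐ ω ∂P, ∀ j, 0 < waitingTime T j ω :=
  ae_all_iff.2 fun j => ae_of_ae_map (hT.measurable_waitingTime j).aemeasurable <|
    (hT.hasLaw j).map_eq ▸ ae_pos_expMeasure hr

lemma IsPoissonEpochs.ae_frequently_one_lt_waitingTime [IsProbabilityMeasure P]
    (hT : IsPoissonEpochs r T P) (hr : 0 < r) :
    ∀ᵐ ω ∂P, ∃ᶠ j in atTop, 1 < waitingTime T j ω := by
  set s : ℕ → Set Ω := fun j => waitingTime T j ⁻¹' Set.Ioi 1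
  have hmeas j : MeasurableSet (s j) := hT.measurable_waitingTime j measurableSet_Ioi
  have hindep : iIndepSet s P := (iIndepSet_iff_meas_biInter hmeas).2 fun S =>
    hT.iIndepFun.measure_inter_preimage_eq_mul S fun _ _ => measurableSet_Ioi
  have hprob j : P (s j) = ENNReal.ofReal (Real.exp (-(r * 1))) := by
    rw [← expMeasure_Ioi hr zero_le_one, ← (hT.hasLaw j).map_eq,
      Measure.map_apply (hT.measurable_waitingTime j) measurableSet_Ioi]
  have hsum : ∑' j, P (s j) = ∞ := by
    simp_rw [hprob]
    exact ENNReal.tsum_const_eq_top_of_ne_zero (by simpa using Real.exp_pos _)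
  filter_upwards [(mem_ae_iff_prob_eq_one (.measurableSet_limsup hmeas)).2
    (measure_limsup_eq_one hmeas hindep hsum)] with ω hω
  exact mem_limsup_iff_frequently_mem.1 hω

lemma IsPoissonEpochs.ae_tendsto_atTop [IsProbabilityMeasure P] (hT : IsPoissonEpochs r T P)
    (hr : 0 < r) : ∀ᵐ ω ∂P, Tendsto (fun j => T j ω) atTop atTop := by
  filter_upwards [hT.ae_waitingTime_pos hr, hT.ae_frequently_one_lt_waitingTime hr]
    with ω hpos hlarge using tendsto_atTop_of_frequently_one_lt_waitingTime hpos hlarge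

end Epochs

section Renewal

lemma lipschitzOnWith_intervalIntegral {E : Type*} [NormedAddCommGroup E] [NormedSpace ℝ E]
    {g : ℝ → E} {C : ℝ≥0} {a b : ℝ} (hg : IntervalIntegrable g volume a b)
    (hC : ∀ x ∈ Set.uIcc a b, ‖g x‖ ≤ C) :
    LipschitzOnWith C (fun y => ∫ z in a..y, g z) (Set.uIcc a b) := by
  refine .of_dist_le_mul fun y hy z hz => ?_
  have hsub {w : ℝ} (hw : w ∈ Set.uIcc a b) : IntervalIntegrable g volume a w :=
    hg.mono_set (Set.uIcc_subset_uIcc_left hw)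
  rw [dist_eq_norm, intervalIntegral.integral_interval_sub_left (hsub hy) (hsub hz),
    Real.dist_eq]
  exact intervalIntegral.norm_integral_le_of_norm_le_const fun u hu =>
    hC u (Set.uIcc_subset_uIcc hz hy (Set.uIoc_subset_uIcc hu))

lemma lipschitzOnWith_cexp_comp {g : ℝ → ℂ} {C : ℝ≥0} {a b : ℝ}
    (hg : LipschitzOnWith C g (Set.uIcc a b)) :
    ∃ C', LipschitzOnWith C' (fun x => Complex.exp (g x)) (Set.uIcc a b) := by
  have hexp : LocallyLipschitz Complex.exp := (Complex.contDiff_exp (𝕜 := ℝ)).locallyLipschitz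
  obtain ⟨D, hD⟩ := hexp.locallyLipschitzOn.exists_lipschitzOnWith_of_compact
    (isCompact_uIcc.image_of_continuousOn hg.continuousOn)
  exact ⟨D * C, hD.comp hg (Set.mapsTo_image _ _)⟩

theorem integral_mul_exp_integral_left {φ : ℝ → ℂ} {C : ℝ≥0} (hφ : Measurable φ)
    (hC : ∀ x, ‖φ x‖ ≤ C) (a b : ℝ) :
    ∫ z in a..b, φ z * Complex.exp (∫ u in a..z, φ u) = Complex.exp (∫ u in a..b, φ u) - 1 := by
  have hφi : IntervalIntegrable φ volume a b :=
    (intervalIntegrable_const (c := (C : ℝ))).mono_fun hφ.aestronglyMeasurable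
      (ae_of_all _ fun x => by simpa using hC x)
  have hΦ := lipschitzOnWith_intervalIntegral hφi fun x _ => hC x
  obtain ⟨D, hD⟩ := lipschitzOnWith_cexp_comp hΦ
  obtain ⟨K, hK⟩ := isCompact_uIcc.exists_bound_of_continuousOn hD.continuousOn
  have hψi := hφi.mul_continuousOn hD.continuousOn
  have hΨ := lipschitzOnWith_intervalIntegral (C := C * K.toNNReal) hψi fun x hx => by
    rw [norm_mul, NNReal.coe_mul]
    gcongr
    exacts [hC x, (hK x hx).trans (Real.le_coe_toNNReal K)]
  have hderiv : ∀ᵐ x, x ∈ Set.uIcc a b → HasDerivAt (fun y => Complex.exp (∫ u in a..y, φ u) -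
      ∫ z in a..y, φ z * Complex.exp (∫ u in a..z, φ u)) 0 x := by
    filter_upwards [hφi.ae_hasDerivAt_integral, hψi.ae_hasDerivAt_integral] with x h₁ h₂ hx
    refine ((h₁ hx a Set.left_mem_uIcc).cexp.sub (h₂ hx a Set.left_mem_uIcc)).congr_deriv ?_
    ring
  obtain ⟨c, hc⟩ := (hD.absolutelyContinuousOnInterval.sub
    hΨ.absolutelyContinuousOnInterval).const_of_ae_hasDerivAt_zero hderiv
  have hab := (hc b Set.right_mem_uIcc).trans (hc a Set.left_mem_uIcc).symm
  simp only [Pi.sub_apply, intervalIntegral.integral_same, Complex.exp_zero, sub_zero] at hab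
  rw [← hab, sub_sub_cancel]

theorem integral_mul_exp_integral_right {φ : ℝ → ℂ} {C : ℝ≥0} (hφ : Measurable φ)
    (hC : ∀ x, ‖φ x‖ ≤ C) (a b : ℝ) :
    ∫ z in a..b, φ z * Complex.exp (∫ u in z..b, φ u) = Complex.exp (∫ u in a..b, φ u) - 1 := by
  have h := integral_mul_exp_integral_left (φ := fun x => -φ x) hφ.neg (by simpa using hC) b a
  simp only [intervalIntegral.integral_neg, neg_mul,
    ← intervalIntegral.integral_symm] at h
  exact h

/-- The expectation of `∏ⱼ f Tⱼ`, where the `Tⱼ` are the points in `(s, ∞)` of a Poisson process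
with rate `r`. -/
noncomputable def poissonFunctional (r : ℝ) (f : ℝ → ℂ) (s : ℝ) : ℂ :=
  Complex.exp (r * ∫ u in Set.Ioi s, (f u - 1))

variable {r M : ℝ} {f : ℝ → ℂ}

lemma poissonFunctional_of_ge (hfM : ∀ u, M < u → f u = 1) {s : ℝ} (hs : M ≤ s) :
    poissonFunctional r f s = 1 := by
  rw [poissonFunctional, setIntegral_eq_zero_of_forall_eq_zero, mul_zero, Complex.exp_zero]
  exact fun u hu => sub_eq_zero.2 (hfM u (hs.trans_lt hu))

lemma norm_poissonFunctional_le (hr : 0 ≤ r) (hf : ∀ u, ‖f u‖ ≤ 1) (s : ℝ) :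
    ‖poissonFunctional r f s‖ ≤ 1 := by
  have hre : (∫ u in Set.Ioi s, (f u - 1)).re ≤ 0 := by
    by_cases hint : IntegrableOn (fun u => f u - 1) (Set.Ioi s)
    · rw [← RCLike.re_eq_complex_re, ← integral_re hint]
      exact integral_nonpos fun u => by simpa using (Complex.re_le_norm (f u)).trans (hf u)
    · rw [integral_undef hint, Complex.zero_re]
  rw [poissonFunctional, Complex.norm_exp, Real.exp_le_one_iff, Complex.re_ofReal_mul]
  exact mul_nonpos_of_nonneg_of_nonpos hr hre

lemma intervalIntegrable_of_norm_le_one (hfm : Measurable f) (hf : ∀ u, ‖f u‖ ≤ 1) (a b : ℝ) :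
    IntervalIntegrable f volume a b :=
  (intervalIntegrable_const (c := (1 : ℝ))).mono_fun hfm.aestronglyMeasurable
    (ae_of_all _ fun u => by simpa using hf u)

lemma poissonFunctional_eq (hfm : Measurable f) (hf : ∀ u, ‖f u‖ ≤ 1)
    (hfM : ∀ u, M < u → f u = 1) (s : ℝ) :
    poissonFunctional r f s =
      Real.exp (-(r * (M - s))) * Complex.exp (∫ u in s..M, (r : ℂ) * f u) := by
  have hi := intervalIntegrable_of_norm_le_one hfm hf s M
  have hzero : Set.EqOn (fun u => f u - 1) (fun _ => 0) (Set.Ioi M) :=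
    fun u hu => sub_eq_zero.2 (hfM u hu)
  have htail : IntegrableOn (fun u => f u - 1) (Set.Ioi M) :=
    integrableOn_zero.congr_fun hzero.symm measurableSet_Ioi
  rw [poissonFunctional, ← intervalIntegral.integral_interval_add_Ioi'
    (hi.sub intervalIntegrable_const) htail, setIntegral_congr_fun measurableSet_Ioi hzero,
    integral_zero, add_zero, intervalIntegral.integral_sub hi intervalIntegrable_const,
    intervalIntegral.integral_const, intervalIntegral.integral_const_mul, Complex.ofReal_exp,
    ← Complex.exp_add, Complex.real_smul]
  congr 1
  push_cast
  ring

lemma measurable_poissonFunctional (hfm : Measurable f) (hf : ∀ u, ‖f u‖ ≤ 1)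
    (hfM : ∀ u, M < u → f u = 1) : Measurable (poissonFunctional r f) := by
  have hi := intervalIntegrable_of_norm_le_one hfm hf
  have hcont : Continuous fun s => ∫ u in s..M, (r : ℂ) * f u := by
    simp_rw [intervalIntegral.integral_symm M]
    exact (intervalIntegral.continuous_primitive (fun a b => (hi a b).const_mul _) M).neg
  simp_rw [funext (poissonFunctional_eq (r := r) hfm hf hfM)]
  fun_prop

lemma integral_Ioi_mul_exp_neg (hr : 0 < r) (M s : ℝ) :
    ∫ z in Set.Ioi M, r * Real.exp (-(r * (z - s))) = Real.exp (-(r * (M - s))) := by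
  have hexp z : r * Real.exp (-(r * (z - s))) = r * Real.exp (r * s) * Real.exp (-r * z) := by
    rw [mul_assoc, ← Real.exp_add]
    ring_nf
  simp_rw [hexp]
  rw [integral_const_mul, integral_exp_mul_Ioi (neg_lt_zero.2 hr), neg_div_neg_eq, mul_assoc,
    mul_div_assoc', ← Real.exp_add, mul_div_cancel₀ _ hr.ne']
  ring_nf

lemma integral_exp_smul_mul_poissonFunctional (hr : 0 ≤ r) (hfm : Measurable f)
    (hf : ∀ u, ‖f u‖ ≤ 1) (hfM : ∀ u, M < u → f u = 1) (s : ℝ) :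
    ∫ z in s..M, (r * Real.exp (-(r * (z - s)))) • (f z * poissonFunctional r f z) =
      poissonFunctional r f s - Real.exp (-(r * (M - s))) := by
  have hexp z : Real.exp (-(r * (M - s))) =
      Real.exp (-(r * (z - s))) * Real.exp (-(r * (M - z))) := by
    rw [← Real.exp_add]
    ring_nf
  have hk z : (r * Real.exp (-(r * (z - s)))) • (f z * poissonFunctional r f z) =
      Real.exp (-(r * (M - s))) * (r * f z * Complex.exp (∫ u in z..M, (r : ℂ) * f u)) := by
    rw [poissonFunctional_eq hfm hf hfM, hexp z, Complex.real_smul]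
    push_cast
    ring
  have hrf u : ‖(r : ℂ) * f u‖ ≤ r.toNNReal := by
    rw [norm_mul, Complex.norm_real, Real.norm_of_nonneg hr, Real.coe_toNNReal _ hr]
    exact mul_le_of_le_one_right hr (hf u)
  simp_rw [hk]
  rw [intervalIntegral.integral_const_mul,
    integral_mul_exp_integral_right (hfm.const_mul _) hrf, mul_sub_one,
    ← poissonFunctional_eq hfm hf hfM]

-- The renewal equation: condition on the first point `s + x` of the process after `s`.
theorem integral_expMeasure_mul_poissonFunctional (hr : 0 < r) (hfm : Measurable f)
    (hf : ∀ u, ‖f u‖ ≤ 1) (hfM : ∀ u, M < u → f u = 1) (s : ℝ) :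
    ∫ x, f (s + x) * poissonFunctional r f (s + x) ∂(expMeasure r) = poissonFunctional r f s := by
  set k : ℝ → ℂ := fun z => (r * Real.exp (-(r * (z - s)))) • (f z * poissonFunctional r f z)
    with hk
  have hkm : Measurable k := by
    have := measurable_poissonFunctional (r := r) hfm hf hfM
    fun_prop
  have hbound z : ‖k z‖ ≤ r * Real.exp (-(r * (z - s))) := by
    rw [hk, norm_smul, Real.norm_of_nonneg (by positivity), norm_mul]
    exact mul_le_of_le_one_right (by positivity)
      (mul_le_one₀ (hf z) (norm_nonneg _) (norm_poissonFunctional_le hr.le hf z))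
  have hki : IntervalIntegrable k volume s M :=
    (Continuous.intervalIntegrable (by fun_prop) s M).mono_fun' hkm.aestronglyMeasurable
      (ae_of_all _ hbound)
  have htail : ∫ z in Set.Ioi M, k z = Real.exp (-(r * (M - s))) := by
    rw [← integral_Ioi_mul_exp_neg hr, ← integral_complex_ofReal]
    refine setIntegral_congr_fun measurableSet_Ioi fun z hz => ?_
    simp only [hk, hfM z hz, poissonFunctional_of_ge hfM (le_of_lt hz), mul_one,
      Complex.real_smul]
  have hkM : IntegrableOn k (Set.Ioi M) := .of_integral_ne_zero <| by
    rw [htail]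
    exact_mod_cast (Real.exp_pos _).ne'
  rw [integral_expMeasure_comp_add hr fun z => f z * poissonFunctional r f z,
    ← intervalIntegral.integral_interval_add_Ioi' hki hkM, htail,
    integral_exp_smul_mul_poissonFunctional hr.le hfm hf hfM, sub_add_cancel]

end Renewal

section PoissonEpochs

lemma integral_eq_integral_integral_of_indepFun {Ω α β E : Type*} [MeasurableSpace Ω]
    [MeasurableSpace α] [MeasurableSpace β] [NormedAddCommGroup E] [NormedSpace ℝ E]
    {P : Measure Ω} [IsFiniteMeasure P] {ν : Measure β} [SFinite ν] {X : Ω → α} {Y : Ω → β}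
    (hX : AEMeasurable X P) (hY : HasLaw Y ν P) (hXY : IndepFun X Y P) {Φ : α × β → E}
    (hΦ : StronglyMeasurable Φ) (hint : Integrable (fun ω => Φ (X ω, Y ω)) P) :
    ∫ ω, Φ (X ω, Y ω) ∂P = ∫ ω, ∫ y, Φ (X ω, y) ∂ν ∂P := by
  have hpair := hX.prodMk hY.aemeasurable
  have hmap := hXY.map_prod_eq_prod_map_map hX hY.aemeasurable
  rw [hY.map_eq] at hmap
  have hint' : Integrable Φ ((P.map X).prod ν) := by
    rwa [← hmap, integrable_map_measure hΦ.aestronglyMeasurable hpair]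
  rw [← integral_map hpair hΦ.aestronglyMeasurable, hmap, integral_prod _ hint',
    integral_map hX hΦ.integral_prod_right'.aestronglyMeasurable]

variable {Ω : Type*} [MeasurableSpace Ω] {P : Measure Ω} {r M : ℝ} {T : ℕ → Ω → ℝ} {f : ℝ → ℂ}

lemma IsPoissonEpochs.indepFun_prod_waitingTime (hT : IsPoissonEpochs r T P)
    (hfm : Measurable f) (n : ℕ) :
    IndepFun (fun ω => (∏ j ∈ Finset.range (n + 1), f (T j ω), T n ω)) (waitingTime T (n + 1))
      P := by
  have hW i := (hT.measurable_waitingTime i).stronglyMeasurable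
  set 𝓕 := Filtration.natural (waitingTime T) hW
  have hTm {j : ℕ} (hj : j ≤ n) : Measurable[𝓕 n] (T j) := by
    simp_rw [← funext (sum_waitingTime (T := T) j)]
    refine Finset.measurable_sum _ fun i hi => ?_
    refine (Filtration.stronglyAdapted_natural hW i).measurable.mono (𝓕.mono ?_) le_rfl
    exact (Nat.lt_succ_iff.1 (Finset.mem_range.1 hi)).trans hj
  have hpair : Measurable[𝓕 n] fun ω => (∏ j ∈ Finset.range (n + 1), f (T j ω), T n ω) :=
    (Finset.measurable_prod _ fun j hj => hfm.comp
      (hTm (Nat.lt_succ_iff.1 (Finset.mem_range.1 hj)))).prodMk (hTm le_rfl)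
  exact (indep_of_indep_of_le_right (hT.iIndepFun.indep_comap_natural_of_lt hW n.lt_succ_self)
    hpair.comap_le).symm

lemma norm_prod_le_one {ι : Type*} {s : Finset ι} {g : ι → ℂ} (h : ∀ i ∈ s, ‖g i‖ ≤ 1) :
    ‖∏ i ∈ s, g i‖ ≤ 1 := by
  rw [norm_prod]
  exact Finset.prod_le_one (fun _ _ => norm_nonneg _) h

theorem IsPoissonEpochs.integral_prod_mul_poissonFunctional [IsProbabilityMeasure P]
    (hT : IsPoissonEpochs r T P) (hr : 0 < r) (hfm : Measurable f) (hf : ∀ u, ‖f u‖ ≤ 1)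
    (hfM : ∀ u, M < u → f u = 1) (n : ℕ) :
    ∫ ω, (∏ j ∈ Finset.range (n + 1), f (T j ω)) * poissonFunctional r f (T n ω) ∂P =
      poissonFunctional r f 0 := by
  have := isProbabilityMeasure_expMeasure hr
  have hpm := measurable_poissonFunctional (r := r) hfm hf hfM
  set k : ℝ → ℂ := fun u => f u * poissonFunctional r f u with hk
  have hkm : Measurable k := hfm.mul hpm
  have hk_le u : ‖k u‖ ≤ 1 := by
    rw [hk, norm_mul]
    exact mul_le_one₀ (hf u) (norm_nonneg _) (norm_poissonFunctional_le hr.le hf u)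
  have hrenewal s := integral_expMeasure_mul_poissonFunctional hr hfm hf hfM s
  induction n with
  | zero =>
    rw [← hrenewal 0, ← (hT.hasLaw 0).integral_comp (by fun_prop)]
    simp [waitingTime]
  | succ n ih =>
    set A : Ω → ℂ := fun ω => ∏ j ∈ Finset.range (n + 1), f (T j ω) with hA
    have hAm : Measurable A := Finset.measurable_prod _ fun j _ => hfm.comp (hT.measurable j)
    have hTn := hT.measurable n
    have hWm := hT.measurable_waitingTime (n + 1)
    have hint : Integrable (fun ω => A ω * k (T n ω + waitingTime T (n + 1) ω)) P := by
      refine .of_bound (by fun_prop) 1 (ae_of_all _ fun ω => ?_)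
      rw [norm_mul]
      exact mul_le_one₀ (norm_prod_le_one fun j _ => hf _) (norm_nonneg _) (hk_le _)
    calc ∫ ω, (∏ j ∈ Finset.range (n + 1 + 1), f (T j ω)) * poissonFunctional r f (T (n + 1) ω) ∂P
      _ = ∫ ω, A ω * k (T n ω + waitingTime T (n + 1) ω) ∂P := by
          refine integral_congr_ae (ae_of_all _ fun ω => ?_)
          simp only [hA, hk, waitingTime, add_sub_cancel, Finset.prod_range_succ, mul_assoc]
      _ = ∫ ω, ∫ x, A ω * k (T n ω + x) ∂(expMeasure r) ∂P :=
          integral_eq_integral_integral_of_indepFun (X := fun ω => (A ω, T n ω))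
            (Φ := fun p => p.1.1 * k (p.1.2 + p.2)) (by fun_prop) (hT.hasLaw (n + 1))
            (hT.indepFun_prod_waitingTime hfm n) (by fun_prop) hint
      _ = ∫ ω, A ω * poissonFunctional r f (T n ω) ∂P := by
          simp only [integral_const_mul, hk, hrenewal]
      _ = poissonFunctional r f 0 := ih

end PoissonEpochs

section Noise

/-- The product `⨂_{j ∈ s} κ (t j)`, as a kernel depending on `t`. -/
noncomputable def piKernel {ι α β : Type*} [MeasurableSpace α] [MeasurableSpace β]
    (κ : Kernel α β) [IsMarkovKernel κ] (s : Finset ι) : Kernel (ι → α) (s → β) where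
  toFun t := Measure.pi fun j => κ (t j)
  measurable' := by
    refine Measurable.measure_of_isPiSystem_of_isProbabilityMeasure generateFrom_pi.symm
      isPiSystem_pi ?_
    rintro _ ⟨A, hA, rfl⟩
    simp only [Measure.pi_pi]
    exact Finset.measurable_prod _ fun j _ =>
      (κ.measurable_coe (hA j (Set.mem_univ j))).comp (measurable_pi_apply _)

lemma piKernel_apply {ι α β : Type*} [MeasurableSpace α] [MeasurableSpace β] (κ : Kernel α β)
    [IsMarkovKernel κ] (s : Finset ι) (t : ι → α) :
    piKernel κ s t = Measure.pi fun j : s => κ (t j) :=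
  rfl

instance {ι α β : Type*} [MeasurableSpace α] [MeasurableSpace β] (κ : Kernel α β)
    [IsMarkovKernel κ] (s : Finset ι) : IsMarkovKernel (piKernel κ s) :=
  ⟨fun t => inferInstanceAs (IsProbabilityMeasure (Measure.pi fun j : s => κ (t j)))⟩

variable {Ω : Type*} [MeasurableSpace Ω] {P : Measure Ω} [IsProbabilityMeasure P]
  {T R : ℕ → Ω → ℝ} {F : Kernel ℝ ℝ} [IsMarkovKernel F]

lemma IsNoiseGivenEpochs.measure_inter (hR : IsNoiseGivenEpochs F T R P)
    (hT : ∀ j, Measurable (T j)) (s : Finset ℕ) {A : ℕ → Set ℝ} (hA : ∀ j, MeasurableSet (A j))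
    {B : Set (ℕ → ℝ)} (hB : MeasurableSet B) :
    P ((fun ω j => T j ω) ⁻¹' B ∩ ⋂ j ∈ s, R j ⁻¹' A j) =
      ∫⁻ ω in (fun ω j => T j ω) ⁻¹' B, ∏ j ∈ s, F (T j ω) (A j) ∂P := by
  set τ : Ω → ℕ → ℝ := fun ω j => T j ω
  set E : Set Ω := ⋂ j ∈ s, R j ⁻¹' A j
  have hτ : Measurable τ := measurable_pi_lambda _ hT
  have hE : MeasurableSet E := s.measurableSet_biInter fun j _ => hR.measurable j (hA j)
  have hcond := hR.condProb_eq s A hA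
  have hset : ∫ ω in τ ⁻¹' B, ∏ j ∈ s, (F (T j ω)).real (A j) ∂P = P.real (τ ⁻¹' B ∩ E) := by
    rw [← setIntegral_congr_ae (hτ hB) (hcond.mono fun ω hω _ => hω),
      setIntegral_condExp hτ.comap_le ((integrable_const _).indicator hE) ⟨B, hB, rfl⟩,
      setIntegral_indicator hE, setIntegral_const, smul_eq_mul, mul_one]
  rw [← ofReal_measureReal, ← hset, ofReal_integral_eq_lintegral_ofReal
    (integrable_condExp.congr hcond).integrableOn
    (ae_of_all _ fun ω => Finset.prod_nonneg fun j _ => measureReal_nonneg)]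
  refine lintegral_congr fun ω => ?_
  rw [ENNReal.ofReal_prod_of_nonneg fun _ _ => measureReal_nonneg]
  exact Finset.prod_congr rfl fun j _ => ofReal_measureReal

lemma IsNoiseGivenEpochs.map_prod_eq_compProd (hR : IsNoiseGivenEpochs F T R P)
    (hT : ∀ j, Measurable (T j)) (s : Finset ℕ) :
    P.map (fun ω => ((fun j => T j ω : ℕ → ℝ), (fun j => R j ω : s → ℝ))) =
      (P.map fun ω j => T j ω) ⊗ₘ piKernel F s := by
  set τ : Ω → ℕ → ℝ := fun ω j => T j ω
  set ρ : Ω → s → ℝ := fun ω j => R j ω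
  have hτ : Measurable τ := measurable_pi_lambda _ hT
  have hpair : Measurable fun ω => (τ ω, ρ ω) :=
    hτ.prodMk (measurable_pi_lambda _ fun j => hR.measurable j)
  have := Measure.isProbabilityMeasure_map (μ := P) hτ.aemeasurable
  have := Measure.isProbabilityMeasure_map (μ := P) hpair.aemeasurable
  refine ext_of_generate_finite _ (generateFrom_eq_prod
    MeasurableSpace.generateFrom_measurableSet
    generateFrom_pi isCountablySpanning_measurableSet
    (.pi fun _ => isCountablySpanning_measurableSet)).symm
    (MeasurableSpace.isPiSystem_measurableSet.prod isPiSystem_pi) ?_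
    (by rw [measure_univ, measure_univ])
  rintro _ ⟨B, hB, _, ⟨A, hA, rfl⟩, rfl⟩
  replace hB : MeasurableSet B := hB
  replace hA j : MeasurableSet (A j) := hA j (Set.mem_univ j)
  have hpiA := MeasurableSet.univ_pi hA
  set A' : ℕ → Set ℝ := fun j => if h : j ∈ s then A ⟨j, h⟩ else Set.univ with hA'
  have hA'm j : MeasurableSet (A' j) := by
    simp only [hA']
    split_ifs
    exacts [hA _, .univ]
  have hpre : (fun ω => (τ ω, ρ ω)) ⁻¹' (B ×ˢ Set.univ.pi A) =
      τ ⁻¹' B ∩ ⋂ j ∈ s, R j ⁻¹' A' j := by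
    ext ω
    simp +contextual [hA', ρ]
  change P.map (fun ω => (τ ω, ρ ω)) (B ×ˢ Set.univ.pi A) = _
  rw [Measure.map_apply hpair (hB.prod hpiA), hpre, hR.measure_inter hT s hA'm hB,
    Measure.compProd_apply_prod hB hpiA, setLIntegral_map hB (Kernel.measurable_coe _ hpiA) hτ]
  refine lintegral_congr fun ω => ?_
  rw [piKernel_apply, Measure.pi_pi, ← Finset.prod_coe_sort]
  simp only [hA', Finset.coe_mem, dif_pos, Subtype.coe_eta, τ]

theorem IsNoiseGivenEpochs.integral_prod_mul (hR : IsNoiseGivenEpochs F T R P)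
    (hT : ∀ j, Measurable (T j)) (s : Finset ℕ) {ψ : ℝ → ℝ → ℂ}
    (hψm : Measurable (Function.uncurry ψ)) (hψ : ∀ u x, ‖ψ u x‖ ≤ 1) {G : (ℕ → ℝ) → ℂ}
    (hGm : Measurable G) (hG : ∀ t, ‖G t‖ ≤ 1) :
    ∫ ω, (∏ j ∈ s, ψ (T j ω) (R j ω)) * G (fun j => T j ω) ∂P =
      ∫ ω, (∏ j ∈ s, ∫ x, ψ (T j ω) x ∂(F (T j ω))) * G (fun j => T j ω) ∂P := by
  set τ : Ω → ℕ → ℝ := fun ω j => T j ω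
  set ρ : Ω → s → ℝ := fun ω j => R j ω
  have hτm : Measurable τ := measurable_pi_lambda _ hT
  have hρm : Measurable ρ := measurable_pi_lambda _ fun j => hR.measurable j
  have := Measure.isProbabilityMeasure_map (μ := P) hτm.aemeasurable
  set Φ : (ℕ → ℝ) × (s → ℝ) → ℂ := fun z => (∏ j : s, ψ (z.1 j) (z.2 j)) * G z.1
  have hΦm : Measurable Φ := by
    refine (Finset.measurable_prod _ fun j _ => ?_).mul (hGm.comp measurable_fst)
    exact hψm.comp (g := Function.uncurry ψ)
      (f := fun z : (ℕ → ℝ) × (s → ℝ) => (z.1 j, z.2 j)) (by fun_prop)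
  have hΦi : Integrable Φ ((P.map τ) ⊗ₘ piKernel F s) := by
    refine .of_bound hΦm.aestronglyMeasurable 1 (ae_of_all _ fun z => ?_)
    rw [norm_mul]
    exact mul_le_one₀ (norm_prod_le_one fun _ _ => hψ _ _) (norm_nonneg _) (hG _)
  calc ∫ ω, (∏ j ∈ s, ψ (T j ω) (R j ω)) * G (τ ω) ∂P
    _ = ∫ ω, Φ (τ ω, ρ ω) ∂P := by
        refine integral_congr_ae (ae_of_all _ fun ω => ?_)
        simp only [Φ, τ, ρ]
        rw [Finset.prod_coe_sort s fun j => ψ (T j ω) (R j ω)]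
    _ = ∫ t, ∫ y, Φ (t, y) ∂(piKernel F s t) ∂(P.map τ) := by
        rw [← Measure.integral_compProd hΦi, ← hR.map_prod_eq_compProd hT s,
          integral_map (hτm.prodMk hρm).aemeasurable hΦm.aestronglyMeasurable]
    _ = ∫ ω, ∫ y, Φ (τ ω, y) ∂(piKernel F s (τ ω)) ∂P :=
        integral_map hτm.aemeasurable
          hΦm.stronglyMeasurable.integral_kernel_prod_right'.aestronglyMeasurable
    _ = ∫ ω, (∏ j ∈ s, ∫ x, ψ (T j ω) x ∂(F (T j ω))) * G (τ ω) ∂P := by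
        refine integral_congr_ae (ae_of_all _ fun ω => ?_)
        simp only [Φ]
        rw [integral_mul_const, piKernel_apply, integral_fintype_prod_eq_prod,
          Finset.prod_coe_sort s fun j => ∫ x, ψ (τ ω j) x ∂(F (τ ω j))]

end Noise

section Campbell

lemma measurable_charFun_kernel {X : Type*} [MeasurableSpace X] (κ : Kernel X ℝ)
    [IsSFiniteKernel κ] {y : X → ℝ} (hy : Measurable y) :
    Measurable fun x => charFun (κ x) (y x) := by
  simp only [charFun_apply_real]
  exact StronglyMeasurable.measurable (StronglyMeasurable.integral_kernel_prod_right'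
    (f := fun z : X × ℝ => Complex.exp (y z.1 * z.2 * Complex.I)) (by fun_prop))

lemma summable_of_eventually_eq_zero {E : Type*} [AddCommMonoid E] [TopologicalSpace E]
    {g : ℕ → E} (hg : ∀ᶠ j in atTop, g j = 0) : Summable g := by
  rw [← Nat.cofinite_eq_atTop, eventually_cofinite] at hg
  exact summable_of_hasFiniteSupport hg

variable {Ω : Type*} [MeasurableSpace Ω] {P : Measure Ω} [IsProbabilityMeasure P] {r M : ℝ}
  {T R : ℕ → Ω → ℝ} {F : Kernel ℝ ℝ} {h : ℝ → ℝ}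

lemma IsPoissonEpochs.ae_summable (hT : IsPoissonEpochs r T P) (hr : 0 < r)
    (hM : ∀ u, M < u → h u = 0) : ∀ᵐ ω ∂P, Summable fun j => h (T j ω) * R j ω := by
  filter_upwards [hT.ae_tendsto_atTop hr] with ω hω
  refine summable_of_eventually_eq_zero ((hω.eventually_gt_atTop M).mono fun j hj => ?_)
  rw [hM _ hj, zero_mul]

lemma IsPoissonEpochs.aemeasurable_tsum (hT : IsPoissonEpochs r T P) (hr : 0 < r)
    (hR : ∀ j, Measurable (R j)) (hh : Measurable h) (hM : ∀ u, M < u → h u = 0) :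
    AEMeasurable (fun ω => ∑' j, h (T j ω) * R j ω) P :=
  aemeasurable_of_tendsto_metrizable_ae atTop
    (fun n => (Finset.measurable_sum (Finset.range n) fun j _ =>
      (hh.comp (hT.measurable j)).mul (hR j)).aemeasurable)
    ((hT.ae_summable hr hM).mono fun _ hω => hω.hasSum.tendsto_sum_nat)

variable [IsMarkovKernel F]

lemma IsNoiseGivenEpochs.integral_prod_cexp_mul_poissonFunctional
    (hR : IsNoiseGivenEpochs F T R P) (hT : IsPoissonEpochs r T P) (hr : 0 < r)
    (hh : Measurable h) (hM : ∀ u, M < u → h u = 0) (n : ℕ) :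
    ∫ ω, (∏ j ∈ Finset.range (n + 1), Complex.exp (h (T j ω) * R j ω * Complex.I)) *
        poissonFunctional r (fun u => charFun (F u) (h u)) (T n ω) ∂P =
      poissonFunctional r (fun u => charFun (F u) (h u)) 0 := by
  have hfm := measurable_charFun_kernel F hh
  have hf u : ‖charFun (F u) (h u)‖ ≤ 1 := norm_charFun_le_one _
  have hfM u (hu : M < u) : charFun (F u) (h u) = 1 := by simp [hM u hu]
  have hnoise := hR.integral_prod_mul hT.measurable (Finset.range (n + 1))
    (ψ := fun u x => Complex.exp (h u * x * Complex.I))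
    (G := fun t => poissonFunctional r (fun u => charFun (F u) (h u)) (t n))
    (by unfold Function.uncurry; fun_prop) (fun u x => ?_)
    ((measurable_poissonFunctional hfm hf hfM).comp (measurable_pi_apply n))
    (fun t => norm_poissonFunctional_le hr.le hf _)
  · simp only [hnoise, ← charFun_apply_real,
      hT.integral_prod_mul_poissonFunctional hr hfm hf hfM n]
  · rw [← Complex.ofReal_mul, Complex.norm_exp_ofReal_mul_I]

lemma IsPoissonEpochs.ae_tendsto_prod_cexp_mul_poissonFunctional (hT : IsPoissonEpochs r T P)
    (hr : 0 < r) (hM : ∀ u, M < u → h u = 0) {f : ℝ → ℂ} (hfM : ∀ u, M < u → f u = 1) :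
    ∀ᵐ ω ∂P, Tendsto (fun n =>
        (∏ j ∈ Finset.range (n + 1), Complex.exp (h (T j ω) * R j ω * Complex.I)) *
          poissonFunctional r f (T n ω)) atTop
      (𝓝 (Complex.exp ((∑' j, h (T j ω) * R j ω : ℝ) * Complex.I))) := by
  filter_upwards [hT.ae_tendsto_atTop hr, hT.ae_summable (R := R) hr hM] with ω hω hsum
  have hexp : Continuous fun x : ℝ => Complex.exp (x * Complex.I) := by fun_prop
  refine ((hexp.tendsto _).comp ((tendsto_add_atTop_iff_nat 1).2
    hsum.hasSum.tendsto_sum_nat)).congr' ?_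
  filter_upwards [hω.eventually_gt_atTop M] with n hn
  rw [poissonFunctional_of_ge hfM hn.le, mul_one, ← Complex.exp_sum, ← Finset.sum_mul]
  push_cast [Function.comp_apply]
  rfl

theorem IsNoiseGivenEpochs.integral_cexp_tsum (hR : IsNoiseGivenEpochs F T R P)
    (hT : IsPoissonEpochs r T P) (hr : 0 < r) (hh : Measurable h)
    (hM : ∀ u, M < u → h u = 0) :
    ∫ ω, Complex.exp ((∑' j, h (T j ω) * R j ω : ℝ) * Complex.I) ∂P =
      Complex.exp (r * ∫ u in Set.Ioi 0, (charFun (F u) (h u) - 1)) := by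
  have hfm := measurable_charFun_kernel F hh
  have hf u : ‖charFun (F u) (h u)‖ ≤ 1 := norm_charFun_le_one _
  have hfM u (hu : M < u) : charFun (F u) (h u) = 1 := by simp [hM u hu]
  have hpm := measurable_poissonFunctional (r := r) hfm hf hfM
  have hTm := hT.measurable
  have hRm := hR.measurable
  refine tendsto_nhds_unique (tendsto_integral_of_dominated_convergence (fun _ => 1)
    (fun n => ?_) (integrable_const _) (fun n => ae_of_all _ fun ω => ?_)
    (hT.ae_tendsto_prod_cexp_mul_poissonFunctional (R := R) hr hM hfM))
    (tendsto_const_nhds.congr fun n =>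
      (hR.integral_prod_cexp_mul_poissonFunctional hT hr hh hM n).symm)
  · fun_prop
  · rw [norm_mul]
    refine mul_le_one₀ (norm_prod_le_one fun j _ => ?_) (norm_nonneg _)
      (norm_poissonFunctional_le hr.le hf _)
    rw [← Complex.ofReal_mul, Complex.norm_exp_ofReal_mul_I]

end Campbell

section ShotNoise

variable {β : ℝ} {I : Finset ℝ≥0}

/-- The function `v ↦ ∑ₜ aₜ (log t - log v)₊ ^ β`, the response of `∑ₜ aₜ S_β(t)` to an epoch
at `v`. -/
noncomputable def responseSum (β : ℝ) {I : Finset ℝ≥0} (a : I → ℝ) (v : ℝ) : ℝ :=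
  ∑ t : I, a t * response β (t / v)

lemma measurable_responseSum (β : ℝ) (a : I → ℝ) : Measurable (responseSum β a) :=
  Finset.measurable_sum _ fun _ _ => (measurable_response_div β _).const_mul _

lemma responseSum_div_const (a : I → ℝ) (q v : ℝ) :
    responseSum β (fun t => a t / q) v = responseSum β a v / q := by
  simp only [responseSum, Finset.sum_div, div_mul_eq_mul_div]

lemma responseSum_of_lt (a : I → ℝ) {v : ℝ} (hv : ((∑ t : I, (t : ℝ≥0) : ℝ≥0) : ℝ) < v) :
    responseSum β a v = 0 := by
  refine Finset.sum_eq_zero fun t _ => ?_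
  have ht : (t : ℝ≥0) ≤ ∑ t : I, (t : ℝ≥0) :=
    Finset.single_le_sum (f := fun t : I => (t : ℝ≥0)) (fun _ _ => zero_le) (Finset.mem_univ t)
  rw [response_div_of_lt ((NNReal.coe_nonneg _).trans_lt hv)
    ((NNReal.coe_le_coe.2 ht).trans_lt hv), mul_zero]

lemma memLp_responseSum (hβ : -1 < 2 * β) (a : I → ℝ) :
    MemLp (responseSum β a) 2 (volume.restrict (Set.Ioi 0)) :=
  memLp_finsetSum _ fun t _ => (memLp_response_div hβ t).const_mul (a t)

theorem integral_responseSum_sq {α : ℝ} (hα : 0 < α) (hα' : ∀ n : ℕ, α ≠ n) (a : I → ℝ) :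
    ∫ v in Set.Ioi (0 : ℝ), responseSum ((α - 1) / 2) a v ^ 2 =
      Real.Gamma α * ∑ s : I, ∑ t : I, a s * a t * hadamardCov α s t := by
  have hi (s t : I) : IntegrableOn (fun v : ℝ => a s * a t *
      (response ((α - 1) / 2) (s / v) * response ((α - 1) / 2) (t / v))) (Set.Ioi 0) :=
    ((memLp_response_div (by linarith) s).integrable_mul
      (memLp_response_div (by linarith) t)).const_mul _
  simp only [responseSum, sq, Finset.sum_mul_sum, mul_mul_mul_comm]
  rw [integral_finsetSum _ fun s _ => integrable_finsetSum _ fun t _ => hi s t]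
  simp only [integral_finsetSum _ fun t _ => hi _ t, integral_const_mul,
    integral_response_mul_response hα hα', Finset.mul_sum, mul_left_comm]

variable {Ω : Type*} [MeasurableSpace Ω] {P : Measure Ω} [IsProbabilityMeasure P] {r : ℝ}
  {T R : ℕ → Ω → ℝ}

lemma response_div_of_max_lt {t u : ℝ} (hu : max t 0 < u) : response β (t / u) = 0 :=
  response_div_of_lt ((le_max_right _ _).trans_lt hu) ((le_max_left _ _).trans_lt hu)

lemma IsPoissonEpochs.aemeasurable_shotNoise (hT : IsPoissonEpochs r T P) (hr : 0 < r)
    (hR : ∀ j, Measurable (R j)) (t : ℝ) : AEMeasurable (shotNoise β T R t) P :=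
  hT.aemeasurable_tsum hr hR (measurable_response_div β t) fun _ hu => response_div_of_max_lt hu

lemma IsPoissonEpochs.ae_sum_mul_shotNoise (hT : IsPoissonEpochs r T P) (hr : 0 < r) (c : ℝ)
    (a : I → ℝ) :
    ∀ᵐ ω ∂P, ∑ t : I, a t * shotNoise β T R (c * (t : ℝ≥0)) ω =
      ∑' j, responseSum β a (T j ω / c) * R j ω := by
  have hsum : ∀ᵐ ω ∂P, ∀ t : I,
      Summable fun j => response β (c * (t : ℝ≥0) / T j ω) * R j ω :=
    ae_all_iff.2 fun t => hT.ae_summable (h := fun u => response β (c * (t : ℝ≥0) / u)) hr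
      fun _ hu => response_div_of_max_lt hu
  filter_upwards [hsum] with ω hω
  simp only [shotNoise, ← tsum_mul_left]
  rw [← Summable.tsum_finsetSum fun t _ => (hω t).mul_left (a t)]
  refine tsum_congr fun j => ?_
  simp only [responseSum, div_div_eq_mul_div, mul_comm _ c, Finset.sum_mul, mul_assoc]

theorem IsNoiseGivenEpochs.integral_cexp_sum_mul_shotNoise {F : Kernel ℝ ℝ} [IsMarkovKernel F]
    (hR : IsNoiseGivenEpochs F T R P) (hT : IsPoissonEpochs r T P) (hr : 0 < r) {c : ℝ}
    (hc : 0 < c) (a : I → ℝ) :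
    ∫ ω, Complex.exp ((∑ t : I, a t * shotNoise β T R (c * (t : ℝ≥0)) ω : ℝ) * Complex.I) ∂P =
      Complex.exp (r * ∫ v in Set.Ioi (0 : ℝ),
        c * (charFun (F (c * v)) (responseSum β a v) - 1)) := by
  have hcampbell := hR.integral_cexp_tsum hT hr
    (h := fun u => responseSum β a (u / c)) (M := c * (∑ t : I, (t : ℝ≥0) : ℝ≥0))
    ((measurable_responseSum β a).comp (measurable_id.div_const c))
    fun u hu => responseSum_of_lt a ((lt_div_iff₀' hc).2 hu)
  have hsubst := integral_comp_mul_left_Ioi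
    (fun u => charFun (F u) (responseSum β a (u / c)) - 1) 0 hc
  simp only [mul_div_cancel_left₀ _ hc.ne', mul_zero] at hsubst
  rw [integral_congr_ae ((hT.ae_sum_mul_shotNoise (R := R) hr c a).mono fun ω hω =>
    congrArg (fun x : ℝ => Complex.exp (x * Complex.I)) hω), hcampbell, integral_const_mul, hsubst,
    Complex.real_smul, Complex.ofReal_inv, mul_inv_cancel_left₀ (Complex.ofReal_ne_zero.2 hc.ne')]

end ShotNoise

section Taylor

variable {μ : Measure ℝ}

lemma taylorWithinEval_uIcc_eq_univ {E : Type*} [NormedAddCommGroup E] [NormedSpace ℝ E]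
    {f : ℝ → E} {n : ℕ} (hf : ContDiff ℝ n f) {x₀ x : ℝ} (hx : x₀ ≠ x) :
    taylorWithinEval f n (Set.uIcc x₀ x) x₀ x = taylorWithinEval f n Set.univ x₀ x := by
  simp only [taylor_within_apply, iteratedDerivWithin_univ]
  refine Finset.sum_congr rfl fun k hk => ?_
  have hkn : (k : WithTop ℕ∞) ≤ n := by
    exact_mod_cast Nat.lt_succ_iff.1 (Finset.mem_range.1 hk)
  rw [iteratedDerivWithin_eq_iteratedDeriv (uniqueDiffOn_uIcc hx) (hf.of_le hkn).contDiffAt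
    Set.left_mem_uIcc]

lemma norm_iteratedDeriv_charFun_le [IsFiniteMeasure μ] {n : ℕ} (hμ : MemLp id n μ) (t : ℝ) :
    ‖iteratedDeriv n (charFun μ) t‖ ≤ ∫ x, |x| ^ n ∂μ := by
  rw [iteratedDeriv_charFun hμ, norm_mul, norm_pow, Complex.norm_I, one_pow, one_mul]
  refine (norm_integral_le_integral_norm _).trans_eq (integral_congr_ae (ae_of_all _ fun x => ?_))
  simp only [norm_mul, norm_pow, Complex.norm_real, Real.norm_eq_abs, ← Complex.ofReal_mul,
    Complex.norm_exp_ofReal_mul_I, mul_one]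

theorem norm_charFun_sub_taylor_le [IsFiniteMeasure μ] {n : ℕ} (hμ : MemLp id (n + 1 : ℕ) μ)
    (y : ℝ) :
    ‖charFun μ y - ∑ k ∈ Finset.range (n + 1),
        (k.factorial : ℂ)⁻¹ * (y * Complex.I) ^ k * ∫ x, x ^ k ∂μ‖ ≤
      |y| ^ (n + 1) / n.factorial * ∫ x, |x| ^ (n + 1) ∂μ := by
  have hμn : MemLp id n μ := hμ.mono_exponent (by exact_mod_cast n.le_succ)
  rw [← taylorWithinEval_charFun_zero hμn]
  rcases eq_or_ne 0 y with rfl | hy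
  · simp
  rw [← taylorWithinEval_uIcc_eq_univ (contDiff_charFun hμn) hy,
    taylor_integral_remainder (contDiff_charFun hμ).contDiffOn]
  refine (intervalIntegral.norm_integral_le_of_norm_le_const
    (C := |y| ^ n / n.factorial * ∫ x, |x| ^ (n + 1) ∂μ) fun t ht => ?_).trans_eq ?_
  · have hty : |y - t| ≤ |y| := by
      simpa using Set.abs_sub_right_of_mem_uIcc (Set.uIoc_subset_uIcc ht)
    rw [iteratedDerivWithin_eq_iteratedDeriv (uniqueDiffOn_uIcc hy)
      (contDiff_charFun hμ).contDiffAt (Set.uIoc_subset_uIcc ht), norm_smul, norm_div, norm_pow,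
      Real.norm_eq_abs, Real.norm_natCast]
    gcongr
    exact norm_iteratedDeriv_charFun_le hμ t
  · rw [sub_zero]
    ring

variable [IsProbabilityMeasure μ]

lemma norm_charFun_sub_one_le (hμ : MemLp id 2 μ) (hmean : ∫ x, x ∂μ = 0) (y : ℝ) :
    ‖charFun μ y - 1‖ ≤ y ^ 2 * ∫ x, x ^ 2 ∂μ := by
  simpa [Finset.sum_range_succ, hmean] using norm_charFun_sub_taylor_le (n := 1) hμ y

lemma norm_charFun_sub_one_add_le (hμ : MemLp id 3 μ) (hmean : ∫ x, x ∂μ = 0) (y : ℝ) :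
    ‖charFun μ y - 1 + (y ^ 2 / 2 * ∫ x, x ^ 2 ∂μ : ℝ)‖ ≤ |y| ^ 3 / 2 * ∫ x, |x| ^ 3 ∂μ := by
  convert! norm_charFun_sub_taylor_le (n := 2) hμ y using 2
  simp [Finset.sum_range_succ, hmean, mul_pow]
  ring

lemma integral_abs_pow_le {m n : ℕ} (hmn : m ≤ n) (hμ : MemLp id n μ) :
    ∫ x, |x| ^ m ∂μ ≤ 1 + ∫ x, |x| ^ n ∂μ := by
  have hint {k : ℕ} (hk : k ≤ n) : Integrable (fun x => |x| ^ k) μ :=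
    (hμ.mono_exponent (by exact_mod_cast hk)).integrable_norm_pow'
  calc ∫ x, |x| ^ m ∂μ
    _ ≤ ∫ x, (1 + |x| ^ n) ∂μ :=
        integral_mono (hint hmn) ((integrable_const 1).add (hint le_rfl)) fun x => ?_
    _ = 1 + ∫ x, |x| ^ n ∂μ := by
        rw [integral_add (integrable_const 1) (hint le_rfl), integral_const, probReal_univ,
          one_smul]
  rcases le_total |x| 1 with hx | hx
  · exact (pow_le_one₀ (abs_nonneg x) hx).trans (le_add_of_nonneg_right (by positivity))
  · exact (pow_le_pow_right₀ hx hmn).trans (le_add_of_nonneg_left zero_le_one)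

lemma memLp_id_of_integrable_pow {μ : Measure ℝ} {n : ℕ} (hn : n ≠ 0)
    (h : Integrable (fun x => x ^ n) μ) : MemLp id n μ := by
  rw [← integrable_norm_rpow_iff aestronglyMeasurable_id (by simpa using hn) (by simp)]
  simpa using h.norm

lemma integral_abs_pow_le_of_even {m n : ℕ} (hmn : m ≤ n) (hn : Even n) (hμ : MemLp id n μ) :
    ∫ x, |x| ^ m ∂μ ≤ 1 + ∫ x, x ^ n ∂μ := by
  simpa only [hn.pow_abs] using integral_abs_pow_le hmn hμ

end Taylor

section Limit

variable {F : Kernel ℝ ℝ} [IsMarkovKernel F] {M G K : ℝ}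

lemma integral_sq_le_of_integral_abs_pow_three_le {μ : Measure ℝ} [IsProbabilityMeasure μ]
    (hμ : MemLp id 3 μ) (hM : ∫ x, |x| ^ 3 ∂μ ≤ M) : ∫ x, x ^ 2 ∂μ ≤ 1 + M := by
  have h : ∫ x, |x| ^ 2 ∂μ ≤ 1 + ∫ x, |x| ^ 3 ∂μ := integral_abs_pow_le (by norm_num) hμ
  simp only [sq_abs] at h
  linarith

lemma norm_mul_charFun_div_sqrt_sub_one_le {μ : Measure ℝ} [IsProbabilityMeasure μ]
    (hμ : MemLp id 2 μ) (hmean : ∫ x, x ∂μ = 0) (hM : ∫ x, x ^ 2 ∂μ ≤ M) {c : ℝ} (hc : 0 < c)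
    (hG : 0 < G) (y : ℝ) :
    ‖(c : ℂ) * (charFun μ (y / √(c * G)) - 1)‖ ≤ M / G * y ^ 2 := by
  rw [norm_mul, Complex.norm_real, Real.norm_of_nonneg hc.le]
  calc c * ‖charFun μ (y / √(c * G)) - 1‖
    _ ≤ c * ((y / √(c * G)) ^ 2 * M) := by
        gcongr
        exact (norm_charFun_sub_one_le hμ hmean _).trans (by gcongr)
    _ = M / G * y ^ 2 := by
        rw [div_pow, Real.sq_sqrt (by positivity)]
        field_simp

lemma norm_mul_charFun_div_sqrt_sub_one_add_le {μ : Measure ℝ} [IsProbabilityMeasure μ]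
    (hμ : MemLp id 3 μ) (hmean : ∫ x, x ∂μ = 0) (hM : ∫ x, |x| ^ 3 ∂μ ≤ M) {c : ℝ} (hc : 0 < c)
    (hG : 0 < G) (y : ℝ) :
    ‖(c : ℂ) * (charFun μ (y / √(c * G)) - 1) + (y ^ 2 * (∫ x, x ^ 2 ∂μ) / (2 * G) : ℝ)‖ ≤
      |y| ^ 3 * M / (2 * √G ^ 3) * (√c)⁻¹ := by
  have hfactor : (c : ℂ) * (charFun μ (y / √(c * G)) - 1) +
      (y ^ 2 * (∫ x, x ^ 2 ∂μ) / (2 * G) : ℝ) =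
      c * (charFun μ (y / √(c * G)) - 1 + ((y / √(c * G)) ^ 2 / 2 * ∫ x, x ^ 2 ∂μ : ℝ)) := by
    rw [mul_add, ← Complex.ofReal_mul, div_pow, Real.sq_sqrt (by positivity)]
    congr 2
    field_simp
  rw [hfactor, norm_mul, Complex.norm_real, Real.norm_of_nonneg hc.le]
  calc _
    _ ≤ c * (|y / √(c * G)| ^ 3 / 2 * M) := by
        gcongr
        exact (norm_charFun_sub_one_add_le hμ hmean _).trans (by gcongr)
    _ = √c ^ 2 * (|y / √(c * G)| ^ 3 / 2 * M) := by rw [Real.sq_sqrt hc.le]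
    _ = |y| ^ 3 * M / (2 * √G ^ 3) * (√c)⁻¹ := by
        rw [abs_div, abs_of_nonneg (Real.sqrt_nonneg _), Real.sqrt_mul hc.le]
        have := Real.sqrt_pos.2 hc
        field_simp

lemma tendsto_mul_charFun_div_sqrt_sub_one (hG : 0 < G)
    (hF : ∀ u : ℝ, 0 < u → MemLp id 3 (F u)) (hmean : ∀ u : ℝ, 0 < u → condMoment F 1 u = 0)
    (hM : ∀ u : ℝ, 0 < u → ∫ x, |x| ^ 3 ∂(F u) ≤ M)
    (hK : Tendsto (condMoment F 2) atTop (𝓝 K)) (y : ℝ) {v : ℝ} (hv : 0 < v) :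
    Tendsto (fun c : ℝ => (c : ℂ) * (charFun (F (c * v)) (y / √(c * G)) - 1)) atTop
      (𝓝 ((-(y ^ 2 * K / (2 * G)) : ℝ) : ℂ)) := by
  simp only [condMoment, pow_one] at hmean
  have hmain : Tendsto (fun c : ℝ => ((-(y ^ 2 * condMoment F 2 (c * v) / (2 * G)) : ℝ) : ℂ))
      atTop (𝓝 ((-(y ^ 2 * K / (2 * G)) : ℝ) : ℂ)) :=
    (Complex.continuous_ofReal.tendsto _).comp
      (((hK.comp (tendsto_id.atTop_mul_const hv)).const_mul _).div_const _).neg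
  have hzero : Tendsto (fun c : ℝ => |y| ^ 3 * M / (2 * √G ^ 3) * (√c)⁻¹) atTop (𝓝 0) := by
    simpa using Real.tendsto_sqrt_atTop.inv_tendsto_atTop.const_mul (|y| ^ 3 * M / (2 * √G ^ 3))
  refine hmain.congr_dist (squeeze_zero' (Eventually.of_forall fun _ => dist_nonneg) ?_ hzero)
  filter_upwards [eventually_gt_atTop 0] with c hc
  have hcv : 0 < c * v := mul_pos hc hv
  rw [dist_comm, dist_eq_norm, Complex.ofReal_neg, sub_neg_eq_add]
  exact norm_mul_charFun_div_sqrt_sub_one_add_le (hF _ hcv) (hmean _ hcv) (hM _ hcv) hc hG y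

theorem tendsto_integral_mul_charFun_div_sqrt_sub_one {η : ℝ → ℝ} (hηm : Measurable η)
    (hη : MemLp η 2 (volume.restrict (Set.Ioi 0))) (hG : 0 < G)
    (hF : ∀ u : ℝ, 0 < u → MemLp id 3 (F u)) (hmean : ∀ u : ℝ, 0 < u → condMoment F 1 u = 0)
    (hM : ∀ u : ℝ, 0 < u → ∫ x, |x| ^ 3 ∂(F u) ≤ M)
    (hK : Tendsto (condMoment F 2) atTop (𝓝 K)) :
    Tendsto (fun c : ℝ => ∫ v in Set.Ioi (0 : ℝ),
        (c : ℂ) * (charFun (F (c * v)) (η v / √(c * G)) - 1)) atTop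
      (𝓝 ((-((∫ v in Set.Ioi 0, η v ^ 2) * K / (2 * G)) : ℝ) : ℂ)) := by
  rw [← integral_mul_const, ← integral_div, ← integral_neg, ← integral_complex_ofReal]
  refine tendsto_integral_filter_of_dominated_convergence (fun v => (1 + M) / G * η v ^ 2)
    (Eventually.of_forall fun c => ?_) ?_ (hη.integrable_sq.const_mul _)
    (ae_restrict_of_forall_mem measurableSet_Ioi fun v hv =>
      tendsto_mul_charFun_div_sqrt_sub_one hG hF hmean hM hK (η v) hv)
  · exact (((measurable_charFun_kernel (F.comap (fun v => c * v) (measurable_const_mul c))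
      (hηm.div_const _)).sub_const 1).const_mul _).aestronglyMeasurable
  · filter_upwards [eventually_gt_atTop 0] with c hc
    refine ae_restrict_of_forall_mem measurableSet_Ioi fun v (hv : 0 < v) => ?_
    have hcv : 0 < c * v := mul_pos hc hv
    simp only [condMoment, pow_one] at hmean
    exact norm_mul_charFun_div_sqrt_sub_one_le ((hF _ hcv).mono_exponent (by norm_num))
      (hmean _ hcv) (integral_sq_le_of_integral_abs_pow_three_le (hF _ hcv) (hM _ hcv)) hc hG _

end Limit

section Distribution

variable {Ω Ω' : Type*} [MeasurableSpace Ω] [MeasurableSpace Ω'] {P : Measure Ω}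
  {P' : Measure Ω'}

lemma charFun_map_toLp {ι : Type*} [Fintype ι] {X : Ω → ι → ℝ} (hX : AEMeasurable X P)
    (a : EuclideanSpace ℝ ι) :
    charFun (P.map fun ω => WithLp.toLp 2 (X ω)) a =
      ∫ ω, Complex.exp ((∑ i, a i * X ω i : ℝ) * Complex.I) ∂P := by
  rw [charFun_apply, integral_map (by fun_prop) (by fun_prop)]
  rfl

/- Mathlib's Lévy continuity theorem is about sequences; a countably generated filter is reached
through its sequences. -/
theorem tendstoInDistribution_of_tendsto_integral_cexp {ι κ : Type*} [Fintype ι] {l : Filter κ}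
    [l.IsCountablyGenerated] [IsProbabilityMeasure P] [IsProbabilityMeasure P']
    {X : κ → Ω → ι → ℝ} {Z : Ω' → ι → ℝ} (hX : ∀ c, AEMeasurable (X c) P)
    (hZ : AEMeasurable Z P')
    (h : ∀ a : ι → ℝ, Tendsto
      (fun c => ∫ ω, Complex.exp ((∑ i, a i * X c ω i : ℝ) * Complex.I) ∂P) l
      (𝓝 (∫ ω, Complex.exp ((∑ i, a i * Z ω i : ℝ) * Complex.I) ∂P'))) :
    TendstoInDistribution X l Z (fun _ => P) P' := by
  have hE : TendstoInDistribution (fun c ω => (WithLp.toLp 2 (X c ω) : EuclideanSpace ℝ ι)) l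
      (fun ω => (WithLp.toLp 2 (Z ω) : EuclideanSpace ℝ ι)) (fun _ => P) P' := by
    refine ⟨fun c => have := hX c; by fun_prop, by fun_prop, tendsto_of_seq_tendsto fun u hu =>
      ProbabilityMeasure.tendsto_iff_tendsto_charFun.2 fun a => ?_⟩
    rw [ProbabilityMeasure.coe_mk, charFun_map_toLp hZ]
    exact ((h a).comp hu).congr fun n => (charFun_map_toLp (hX (u n)) a).symm
  exact hE.continuous_comp (g := fun x => WithLp.ofLp x) (by fun_prop)

end Distribution

section FDD

variable {Ω Ω' : Type*} [MeasurableSpace Ω] [MeasurableSpace Ω'] {P : Measure Ω}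
  [IsProbabilityMeasure P] {P' : Measure Ω'} {α r K : ℝ} {I : Finset ℝ≥0}

lemma integral_cexp_of_hasGaussianLaw {X : Ω' → ℝ} (hX : HasGaussianLaw X P')
    (hmean : ∫ ω, X ω ∂P' = 0) :
    ∫ ω, Complex.exp (X ω * Complex.I) ∂P' = Complex.exp ((-(Var[X; P'] / 2) : ℝ)) := by
  simpa [charFun_apply_real, integral_map hX.aemeasurable (by fun_prop : AEStronglyMeasurable
    (fun x : ℝ => Complex.exp (x * Complex.I)) _), hmean, neg_div] using hX.charFun_map_eq 1

theorem IsHadamardFBM.integral_cexp_sum {B : ℝ≥0 → Ω' → ℝ} (hB : IsHadamardFBM α P' B)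
    (a : I → ℝ) :
    ∫ ω, Complex.exp ((∑ t : I, a t * B t ω : ℝ) * Complex.I) ∂P' =
      Complex.exp ((-((∑ s : I, ∑ t : I, a s * a t * hadamardCov α s t) / 2) : ℝ)) := by
  have := hB.isGaussianProcess.isProbabilityMeasure
  have hmem (t : I) : MemLp (fun ω => a t * B t ω) 2 P' :=
    (hB.isGaussianProcess.hasGaussianLaw_eval t).memLp_two.const_mul (a t)
  have hlaw : HasGaussianLaw (fun ω => ∑ t : I, a t * B t ω) P' := by
    simpa using (hB.isGaussianProcess.hasGaussianLaw I).map_fun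
      (∑ t : I, a t • ContinuousLinearMap.proj (R := ℝ) (φ := fun _ : I => ℝ) t)
  have hmean : ∫ ω, ∑ t : I, a t * B t ω ∂P' = 0 := by
    rw [integral_finsetSum _ fun t _ => (hmem t).integrable (by norm_num)]
    simp only [integral_const_mul, hB.mean_zero, mul_zero, Finset.sum_const_zero]
  have hvar : Var[fun ω => ∑ t : I, a t * B t ω; P'] =
      ∑ s : I, ∑ t : I, a s * a t * hadamardCov α s t := by
    rw [← covariance_self hlaw.aemeasurable, covariance_fun_sum_fun_sum hmem hmem]
    simp only [covariance_const_mul_left, covariance_const_mul_right, hB.covariance_eq,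
      mul_left_comm, mul_assoc]
  rw [integral_cexp_of_hasGaussianLaw hlaw hmean, hvar]

theorem IsHadamardFBM.tendstoFDD [IsProbabilityMeasure P'] {B : ℝ≥0 → Ω' → ℝ}
    (hB : IsHadamardFBM α P' B) (hα : 0 < α) (hα' : ∀ n : ℕ, α ≠ n) (hr : 0 < r)
    {T R : ℕ → Ω → ℝ} {F : Kernel ℝ ℝ} [IsMarkovKernel F] (hT : IsPoissonEpochs r T P)
    (hR : IsNoiseGivenEpochs F T R P) (hF : ∀ u : ℝ, 0 < u → MemLp id 3 (F u))
    (hmean : ∀ u : ℝ, 0 < u → condMoment F 1 u = 0) {M : ℝ}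
    (hM : ∀ u : ℝ, 0 < u → ∫ x, |x| ^ 3 ∂(F u) ≤ M) (hK : 0 < K)
    (hKlim : Tendsto (condMoment F 2) atTop (𝓝 K)) :
    TendstoFDD (scaledShotNoise α r K T R) P B P' := by
  intro I
  have hG : 0 < K * r * Real.Gamma α := by have := Real.Gamma_pos_of_pos hα; positivity
  refine tendstoInDistribution_of_tendsto_integral_cexp
    (fun c => aemeasurable_pi_lambda _ fun t : I =>
      (hT.aemeasurable_shotNoise hr hR.measurable (c * (t : ℝ≥0))).div_const _)
    (aemeasurable_pi_lambda _ fun t : I => hB.isGaussianProcess.aemeasurable t) fun a => ?_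
  have hlim := tendsto_integral_mul_charFun_div_sqrt_sub_one
    (measurable_responseSum ((α - 1) / 2) a) (memLp_responseSum (by linarith) a) hG hF hmean hM
    hKlim
  have hvalue : (r : ℂ) * ((-((∫ v in Set.Ioi 0, responseSum ((α - 1) / 2) a v ^ 2) * K /
      (2 * (K * r * Real.Gamma α))) : ℝ) : ℂ) =
      ((-((∑ s : I, ∑ t : I, a s * a t * hadamardCov α s t) / 2) : ℝ) : ℂ) := by
    have hΓ : Real.Gamma α ≠ 0 := (Real.Gamma_pos_of_pos hα).ne'
    rw [integral_responseSum_sq hα hα', ← Complex.ofReal_mul]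
    congr 1
    field_simp
  rw [hB.integral_cexp_sum a, ← hvalue]
  refine ((Complex.continuous_exp.tendsto _).comp (hlim.const_mul (r : ℂ))).congr' ?_
  filter_upwards [eventually_gt_atTop 0] with c hc
  have hcexp := hR.integral_cexp_sum_mul_shotNoise hT hr hc (β := (α - 1) / 2)
    fun t => a t / √(c * (K * r * Real.Gamma α))
  simp only [responseSum_div_const] at hcexp
  simp only [scaledShotNoise, ← mul_div_assoc, div_mul_eq_mul_div] at hcexp ⊢
  exact hcexp.symm

end FDD

end HadamardShotNoise

theorem theorem3p1_general {Ω : Type*} [MeasurableSpace Ω] (P : Measure Ω) [IsProbabilityMeasure P]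
    (α : ℝ) (hα : 0 < α) (hα' : ∀ n : ℕ, α ≠ n) (r : ℝ) (hr : 0 < r)
    (T R : ℕ → Ω → ℝ) (F : Kernel ℝ ℝ) [IsMarkovKernel F]
    (hT : HadamardShotNoise.IsPoissonEpochs r T P)
    (hR : HadamardShotNoise.IsNoiseGivenEpochs F T R P)
    (hF : ∀ u : ℝ, 0 < u → MemLp id 3 (F u))
    (hK1 : ∀ u : ℝ, 0 < u → HadamardShotNoise.condMoment F 1 u = 0)
    (hbdd : ∃ M : ℝ, ∀ u : ℝ, 0 < u → ∫ x, |x| ^ 3 ∂(F u) ≤ M)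
    (K : ℝ) (hK : 0 < K)
    (hK2lim : Tendsto (HadamardShotNoise.condMoment F 2) atTop (𝓝 K)) :
    (∃ (Ω₀ : Type) (_ : MeasurableSpace Ω₀) (P₀ : Measure Ω₀) (B₀ : ℝ≥0 → Ω₀ → ℝ),
      HadamardShotNoise.IsHadamardFBM α P₀ B₀) ∧
    ∀ (Ω' : Type*) [MeasurableSpace Ω'] (P' : Measure Ω') [IsProbabilityMeasure P']
      (B : ℝ≥0 → Ω' → ℝ), HadamardShotNoise.IsHadamardFBM α P' B →
      HadamardShotNoise.TendstoFDD
        (HadamardShotNoise.scaledShotNoise α r K T R) P B P' := by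
  obtain ⟨M, hM⟩ := hbdd
  exact ⟨HadamardShotNoise.exists_isHadamardFBM hα hα', fun _ _ _ _ _ hB =>
    hB.tendstoFDD hα hα' hr hT hR hF hK1 hM hK hK2lim⟩

theorem theorem3p1 {Ω : Type*} [MeasurableSpace Ω] (P : Measure Ω) [IsProbabilityMeasure P]
    (α : ℝ) (hα : 1 < α ∧ α < 2) (r : ℝ) (hr : 0 < r)
    (T R : ℕ → Ω → ℝ) (F : Kernel ℝ ℝ) [IsMarkovKernel F]
    (hT : HadamardShotNoise.IsPoissonEpochs r T P)
    (hR : HadamardShotNoise.IsNoiseGivenEpochs F T R P)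
    (hfin : ∀ m ∈ Finset.Icc 1 4, ∀ u : ℝ, 0 < u → Integrable (fun x : ℝ => x ^ m) (F u))
    (hK1 : ∀ u : ℝ, 0 < u → HadamardShotNoise.condMoment F 1 u = 0)
    (hK2pos : ∀ u : ℝ, 0 < u → 0 < HadamardShotNoise.condMoment F 2 u)
    (hK4pos : ∀ u : ℝ, 0 < u → 0 < HadamardShotNoise.condMoment F 4 u)
    (hK2bdd : ∃ M : ℝ, ∀ u : ℝ, 0 < u → HadamardShotNoise.condMoment F 2 u ≤ M)
    (hK4bdd : ∃ M : ℝ, ∀ u : ℝ, 0 < u → HadamardShotNoise.condMoment F 4 u ≤ M)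
    (K : ℝ) (hK : 0 < K)
    (hK2lim : Tendsto (HadamardShotNoise.condMoment F 2) atTop (𝓝 K))
    (κ : ℝ) (hκ : 0 < κ)
    (hK42 : ∀ u : ℝ, 0 < u →
      HadamardShotNoise.condMoment F 4 u / HadamardShotNoise.condMoment F 2 u ≤ κ) :
    (∃ (Ω₀ : Type) (_ : MeasurableSpace Ω₀) (P₀ : Measure Ω₀) (B₀ : ℝ≥0 → Ω₀ → ℝ),
      HadamardShotNoise.IsHadamardFBM α P₀ B₀) ∧
    ∀ (Ω' : Type*) [MeasurableSpace Ω'] (P' : Measure Ω') [IsProbabilityMeasure P']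
      (B : ℝ≥0 → Ω' → ℝ), HadamardShotNoise.IsHadamardFBM α P' B →
      HadamardShotNoise.TendstoFDD
        (HadamardShotNoise.scaledShotNoise α r K T R) P B P' := by
  obtain ⟨M, hM⟩ := hK4bdd
  have h4 (u : ℝ) (hu : 0 < u) : MemLp id 4 (F u) :=
    HadamardShotNoise.memLp_id_of_integrable_pow four_ne_zero (hfin 4 (by simp) u hu)
  exact theorem3p1_general P α (by linarith) (fun n hn => by rw [hn] at hα; norm_cast at hα; omega)
    r hr T R F hT hR (fun u hu => (h4 u hu).mono_exponent (by norm_num)) hK1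
    ⟨1 + M, fun u hu => (HadamardShotNoise.integral_abs_pow_le_of_even (by norm_num) (by decide)
      (h4 u hu)).trans (add_le_add_right (hM u hu) 1)⟩ K hK hK2lim
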